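/- **Proposition 3.1.** Let $d,d',s$ be integers with $0<s<d$, $d'\ge 0$. Let $\alpha\in(0,1]$ and let $K:\mathbb R^d\setminus\{0\}\to\mathbb C^{d'}$ be an $s$-dimensional Calderón–Zygmund kernel, that is, $|K(x)|\le |x|^{-s}$, $K(-x)=-K(x)$, $K(\lambda x)=\lambda^{-s}K(x)$ for $\lambda>0$, and $x\mapsto |x|^{s+\alpha}K(x)$ is Hölder continuous of order $\alpha$ on $\mathbb R^d\setminus\{0\}$. Let $T$ be the associated operator (CZO). Measures are non-negative locally finite Borel measures on $\mathbb R^d$, and $\operatorname{supp}\mu$ is the closed support of $\mu$. - $\mu$ is *$s$-AD regular* if for some $\Lambda>0$ one has $\mu(B(x,r))\le\Lambda r^s$ for all $x\in\mathbb R^d$, $r>0$, and $\mu(B(x,r))\ge\Lambda^{-1}r^s$ for all $x\in\operatorname{supp}\mu$, $r>0$. - $T$ is *bounded in $L^2(\mu)$* if $\sup_{\delta>0}\|T_{\mu,\delta}\|_{L^2(\mu)\to L^2(\mu)}<\infty$, where $T_{\mu,\delta}f(x)=\int K_\delta(x-y)f(y)\,d\mu(y)$, $K_\delta(x)=K(x)\bigl(|x|/\max(|x|,\delta)\bigr)^{s+\alpha}$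 for $x\neq 0$, and $K_\delta(0)=0$. - $\operatorname{Lip}_0(\mathbb R^d)$ is the set of compactly supported complex-valued Lipschitz functions. $\mu$ is *reflectionless* for $T$ if $(x,y)\mapsto|x-y|^{-(s-1)}$ is in $L^1_{\mathrm{loc}}(\mu\times\mu)$, $\int_{|x|\ge1}|x|^{-s-\alpha}\,d\mu(x)<\infty$, and $\langle T(f\mu),1\rangle_\mu=0$ for every $f\in\operatorname{Lip}_0(\mathbb R^d)$ with $\int f\,d\mu=0$. Here $$\langle T(f\mu),1\rangle_\mu=\iint K(x-y)\,\tfrac12\bigl[f(y)\psi(x)-\psi(y)f(x)\bigr]\,d\mu(x)\,d\mu(y)+\int\Bigl(\int K(x-y)f(y)\,d\mu(y)\Bigr)(1-\psi(x))\,d\mu(x)$$ for any $\psi\in\operatorname{Lip}_0(\mathbb R^d)$ that is identically $1$ on a neighbourhood of $\operatorname{supp}f$ (the value does not depend on $\psi$). - $\mathcal D$ is a lattice of open dyadic cubes: for some $\lambda>0$ and each $k\in\mathbb Z$, the cubes of generation $k$ are the open cells of a translate of the grid of axis-parallel cubes of sidelength $2^k\lambda$, and the grid of generation $k$ refines the grid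 of generation $k+1$. $\ell(Q)$ is the sidelength of $Q$, and $3Q$ is the concentric cube of sidelength $3\ell(Q)$. - For $\delta>0$, a cube $Q\in\mathcal D$ is *$\delta$-non-LCV* for $\mu$ if there are $x,y\in\overline{3Q}\cap\operatorname{supp}\mu$ with $B(\tfrac{x+y}2,\delta\ell(Q))\cap\operatorname{supp}\mu=\varnothing$. Assume that every non-zero $s$-AD regular measure that is reflectionless for $T$ is of the form $c\,\mathcal H^s|L$ for a constant $c>0$ and an $s$-plane (an $s$-dimensional affine subspace) $L$ of $\mathbb R^d$. Let $\mu$ be an $s$-AD regular measure for which $T$ is bounded in $L^2(\mu)$, and let $\mathcal D$ be a lattice of open dyadic cubes. Then for every $\delta>0$ the $\delta$-non-LCV cubes of $\mathcal D$ form a Carleson family: there is $C_\delta>0$ such that for every $P\in\mathcal D$ $$\sum_{\substack{Q\in\mathcal D:\ Q\subset P,\\ Q\text{ is }\delta\text{-non-LCV}}}\ell(Q)^s\le C_\delta\,\ell(P)^s.$$ -/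

import Mathlib

open MeasureTheory
open scoped NNReal ENNReal

noncomputable section

/-- The Euclidean space `ℝ^d`. -/
abbrev RSpace (d : ℕ) : Type := EuclideanSpace ℝ (Fin d)

/-- The Euclidean (Hermitian) space `ℂ^d'`. -/
abbrev CSpace (d' : ℕ) : Type := EuclideanSpace ℂ (Fin d')

/-! ## Ahlfors-David regular measures -/

/-- `μ` is `Λ`-nice: `μ(B(x,r)) ≤ Λ r^s` for every ball. -/
def IsNiceWith {d : ℕ} (s : ℕ) (Λ : ℝ) (μ : Measure (RSpace d)) : Prop :=
  ∀ (x : RSpace d) (r : ℝ), 0 < r → μ (Metric.ball x r) ≤ ENNReal.ofReal (Λ * r ^ s)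

/-- `μ` is `Λ`-Ahlfors-David regular of dimension `s`: it is `Λ`-nice and
`μ(B(x,r)) ≥ Λ⁻¹ r^s` for every `x` in the closed support of `μ` and every `r > 0`. -/
def IsADRegularWith {d : ℕ} (s : ℕ) (Λ : ℝ) (μ : Measure (RSpace d)) : Prop :=
  IsNiceWith s Λ μ ∧
    ∀ x ∈ μ.support, ∀ r : ℝ, 0 < r → ENNReal.ofReal (1 / Λ * r ^ s) ≤ μ (Metric.ball x r)

/-- `μ` is `s`-Ahlfors-David regular. -/
def IsADRegular {d : ℕ} (s : ℕ) (μ : Measure (RSpace d)) : Prop :=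
  ∃ Λ : ℝ, 0 < Λ ∧ IsADRegularWith s Λ μ

/-! ## Calderón-Zygmund kernels and operators -/

/-- `K` is a homogeneous `s`-dimensional Calderón-Zygmund kernel with Hölder exponent `α`.
The kernel lives on `ℝ^d \ {0}`: nothing is required of the value `K 0`, and no notion below
depends on it. -/
structure IsCZKernel {d d' : ℕ} (s : ℕ) (α : ℝ) (K : RSpace d → CSpace d') : Prop where
  alpha_pos : 0 < α
  alpha_le_one : α ≤ 1
  bound : ∀ x, x ≠ 0 → ‖K x‖ ≤ 1 / ‖x‖ ^ s
  odd : ∀ x, x ≠ 0 → K (-x) = -K x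
  holder : ∃ C : ℝ, ∀ x y, x ≠ 0 → y ≠ 0 →
    ‖(‖x‖ ^ ((s : ℝ) + α)) • K x - (‖y‖ ^ ((s : ℝ) + α)) • K y‖ ≤ C * ‖x - y‖ ^ α
  homogeneous : ∀ (t : ℝ) (x : RSpace d), 0 < t → x ≠ 0 → K (t • x) = (t ^ s)⁻¹ • K x

/-- The regularized kernel `K_δ(x) = K(x) (|x| / max(|x|,δ))^(s+α)`; it vanishes at `x = 0`,
because the scalar factor does. -/
def regKernel {d d' : ℕ} (s : ℕ) (α : ℝ) (K : RSpace d → CSpace d') (δ : ℝ)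
    (x : RSpace d) : CSpace d' :=
  ((‖x‖ / max ‖x‖ δ) ^ ((s : ℝ) + α)) • K x

/-- The regularized operator `T_{μ,δ}(f)(x) = ∫ K_δ(x-y) f(y) dμ(y)`. -/
def regOperator {d d' : ℕ} (s : ℕ) (α : ℝ) (K : RSpace d → CSpace d')
    (μ : Measure (RSpace d)) (δ : ℝ) (f : RSpace d → ℂ) (x : RSpace d) : CSpace d' :=
  ∫ y, f y • regKernel s α K δ (x - y) ∂μ

/-- The operator `T` with kernel `K` is bounded in `L²(μ)`: the `L²(μ) → L²(μ)` operator norms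
of `T_{μ,δ}` are bounded uniformly in `δ > 0`. -/
def IsBoundedInL2 {d d' : ℕ} (s : ℕ) (α : ℝ) (K : RSpace d → CSpace d')
    (μ : Measure (RSpace d)) : Prop :=
  ∃ C : ℝ≥0, ∀ δ : ℝ, 0 < δ → ∀ f : RSpace d → ℂ, MemLp f 2 μ →
    eLpNorm (regOperator s α K μ δ f) 2 μ ≤ C * eLpNorm f 2 μ

/-! ## Reflectionless measures -/

/-- `f ∈ Lip_0(ℝ^d)`: `f` is Lipschitz and compactly supported. -/
def IsLipZero {d : ℕ} (f : RSpace d → ℂ) : Prop :=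
  (∃ L : ℝ≥0, LipschitzWith L f) ∧ HasCompactSupport f

/-- `μ` is diffuse: `(x,y) ↦ |x-y|^(-(s-1))` is locally integrable for `μ × μ`. -/
def IsDiffuse {d : ℕ} (s : ℕ) (μ : Measure (RSpace d)) : Prop :=
  ∀ R : ℝ, ∫⁻ z in Metric.ball (0 : RSpace d) R ×ˢ Metric.ball (0 : RSpace d) R,
    (‖z.1 - z.2‖ₑ ^ ((s : ℝ) - 1))⁻¹ ∂(μ.prod μ) < ∞

/-- `μ` has restricted growth at infinity: `∫_{|x| ≥ 1} |x|^(-(s+α)) dμ(x) < ∞`. -/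
def HasRestrictedGrowth {d : ℕ} (s : ℕ) (α : ℝ) (μ : Measure (RSpace d)) : Prop :=
  ∫⁻ x in {x : RSpace d | 1 ≤ ‖x‖}, (‖x‖ₑ ^ ((s : ℝ) + α))⁻¹ ∂μ < ∞

/-- `⟨T(fμ), φ⟩_μ = ∬ K(x-y) H_{f,φ}(x,y) dμ(x) dμ(y)` for `f, φ ∈ Lip_0(ℝ^d)`, where
`H_{f,φ}(x,y) = (f(y) φ(x) - φ(y) f(x)) / 2`. -/
def lipPairing {d d' : ℕ} (K : RSpace d → CSpace d') (μ : Measure (RSpace d))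
    (f φ : RSpace d → ℂ) : CSpace d' :=
  ∫ z : RSpace d × RSpace d,
    ((1 / 2 : ℂ) * (f z.2 * φ z.1 - φ z.2 * f z.1)) • K (z.1 - z.2) ∂(μ.prod μ)

/-- `⟨T(fμ), φ⟩_μ` for `f ∈ Lip_0(ℝ^d)` of `μ`-mean zero and `φ` bounded and Lipschitz,
computed with the cutoff `ψ ∈ Lip_0(ℝ^d)`, which should be identically `1` on a neighbourhood of
the support of `f`:
`⟨T(fμ), ψφ⟩_μ + ∫ T(fμ)(x) (1 - ψ(x)) φ(x) dμ(x)`, with `T(fμ)(x) = ∫ K(x-y) f(y) dμ(y)`. -/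
def extPairing {d d' : ℕ} (K : RSpace d → CSpace d') (μ : Measure (RSpace d))
    (ψ f φ : RSpace d → ℂ) : CSpace d' :=
  lipPairing K μ f (fun x => ψ x * φ x) +
    ∫ x, ((1 - ψ x) * φ x) • (∫ y, f y • K (x - y) ∂μ) ∂μ

/-- `μ` is reflectionless for the operator `T` with kernel `K`: it is diffuse, has restricted
growth at infinity, and `⟨T(fμ), 1⟩_μ = 0` for every `f ∈ Lip_0(ℝ^d)` with `∫ f dμ = 0`.
The value of `⟨T(fμ), 1⟩_μ` is the same for all admissible cutoffs `ψ`. -/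
def IsReflectionless {d d' : ℕ} (s : ℕ) (α : ℝ) (K : RSpace d → CSpace d')
    (μ : Measure (RSpace d)) : Prop :=
  IsDiffuse s μ ∧ HasRestrictedGrowth s α μ ∧
    ∀ f : RSpace d → ℂ, IsLipZero f → ∫ x, f x ∂μ = 0 →
      ∀ ψ : RSpace d → ℂ, IsLipZero ψ →
        (∃ U : Set (RSpace d), IsOpen U ∧ tsupport f ⊆ U ∧ ∀ x ∈ U, ψ x = 1) →
        extPairing K μ ψ f (fun _ => 1) = 0

/-- `μ = c H^s|L` for a constant `c > 0` and an `s`-plane (`s`-dimensional affine subspace) `L`. -/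
def IsPlaneMeasure {d : ℕ} (s : ℕ) (μ : Measure (RSpace d)) : Prop :=
  ∃ (c : ℝ≥0) (L : AffineSubspace ℝ (RSpace d)), 0 < c ∧ (L : Set (RSpace d)).Nonempty ∧
    Module.finrank ℝ L.direction = s ∧
    μ = c • (Measure.hausdorffMeasure (s : ℝ)).restrict (L : Set (RSpace d))

/-- AD-rigidity: the only `s`-AD regular reflectionless measures, other than the zero measure
(which is reflectionless for every `T`), are the measures `c H^s|L`. -/
def IsADRigid {d d' : ℕ} (s : ℕ) (α : ℝ) (K : RSpace d → CSpace d') : Prop :=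
  ∀ ν : Measure (RSpace d), IsLocallyFiniteMeasure ν → ν ≠ 0 → IsADRegular s ν →
    IsReflectionless s α K ν → IsPlaneMeasure s ν

/-! ## Dyadic lattices and Carleson families -/

/-- The open cube with centre `c` and sidelength `l`, with sides parallel to the axes. -/
def openCube {d : ℕ} (c : RSpace d) (l : ℝ) : Set (RSpace d) :=
  {x | ∀ i, |x i - c i| < l / 2}

/-- A lattice of open dyadic cubes (a translated and rescaled one is allowed). For each `k : ℤ`
the cubes of generation `k` form a grid of sidelength `scale * 2^k` with a vertex at `origin k`,
and the grid of generation `k` refines the grid of generation `k + 1`. -/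
structure DyadicLattice (d : ℕ) where
  scale : ℝ
  scale_pos : 0 < scale
  origin : ℤ → RSpace d
  nested : ∀ k : ℤ, ∃ n : Fin d → ℤ, ∀ i,
    origin (k + 1) i = origin k i + scale * (2 : ℝ) ^ k * (n i : ℝ)

/-- Labels for the cubes of a dyadic lattice: the generation, and the position in the grid. -/
abbrev DyadicIndex (d : ℕ) : Type := ℤ × (Fin d → ℤ)

namespace DyadicLattice

variable {d : ℕ} (D : DyadicLattice d)

/-- The sidelength `ℓ(Q)`. -/
def side (Q : DyadicIndex d) : ℝ := D.scale * (2 : ℝ) ^ Q.1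

/-- The centre `x_Q`. -/
def center (Q : DyadicIndex d) : RSpace d :=
  WithLp.toLp 2 fun i => D.origin Q.1 i + D.side Q * ((Q.2 i : ℝ) + 1 / 2)

/-- The open cube `Q`. -/
def cube (Q : DyadicIndex d) : Set (RSpace d) := openCube (D.center Q) (D.side Q)

/-- The concentric cube `3Q`. -/
def tripleCube (Q : DyadicIndex d) : Set (RSpace d) := openCube (D.center Q) (3 * D.side Q)

/-- `Q` is `δ`-non-LCV for `μ`: there are `x, y ∈ closure (3Q) ∩ supp μ` such that the ball
`B((x+y)/2, δ ℓ(Q))` does not meet `supp μ`. -/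
def IsNonLCV (μ : Measure (RSpace d)) (δ : ℝ) (Q : DyadicIndex d) : Prop :=
  ∃ x ∈ closure (D.tripleCube Q) ∩ μ.support, ∃ y ∈ closure (D.tripleCube Q) ∩ μ.support,
    Metric.ball ((1 / 2 : ℝ) • (x + y)) (δ * D.side Q) ∩ μ.support = ∅

/-- The family `F` of cubes of the lattice is a Carleson family: for some `C > 0`,
`∑_{Q ∈ F, Q ⊆ P} ℓ(Q)^s ≤ C ℓ(P)^s` for every cube `P` of the lattice. -/
def IsCarlesonFamily (s : ℕ) (F : Set (DyadicIndex d)) : Prop :=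
  ∃ C : ℝ, 0 < C ∧ ∀ P : DyadicIndex d,
    ∑' Q : {Q : DyadicIndex d // Q ∈ F ∧ D.cube Q ⊆ D.cube P}, ENNReal.ofReal (D.side Q.1 ^ s)
      ≤ ENNReal.ofReal (C * D.side P ^ s)

end DyadicLattice

end

/-!
The theorem is proved by compactness, followed by a Bessel inequality.

**Non-flatness forces `T` to act.** Let `m` range over the `Λ`-regular measures that have two points
`x, y` of the support in a fixed ball while `B((x+y)/2, δ)` misses the support. Then there are
constants `A, Δ > 0` such that each of these measures admits a Lipschitz bump `f` of `m`-mean zero,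
supported in `B(0,A)`, for which `|⟨T(fm), χ⟩_m| ≥ Δ` for *every* Lipschitz cutoff `χ` equal to `1`
on `B(0,A)` (`exists_large_lipPairing`). Otherwise there is a sequence of such measures without a
good bump. Along an ultrafilter it has a vague limit `ν`, provided by the Riesz–Markov–Kakutani
theorem (`exists_vagueTendsto`). The measure `ν` is regular, its support still contains two points
without their midpoint, and it is reflectionless (`isReflectionless_of_vagueTendsto`). By rigidity
`ν = c H^s|L`, whose support contains the midpoint of any two of its points: a contradiction.

Two uniform estimates allow the passage to the limit. The antisymmetrized kernel is
`O(|x-y|^(1-s))`, so that truncating it at scale `ε` costs `O(ε)`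
(`norm_lipPairing_sub_regKernel_le`); the truncated forms converge because vague convergence passes
to product measures (`VagueTendsto.tendsto_integral_prod`). For `f` of mean zero, `T(fμ)` decays
like `|x|^(-s-α)`, so that `⟨T(fμ), 1⟩_μ` is computed up to `O(N^(-α))` by any cutoff that is `1` on
`B(0,N)` (`exists_norm_lipPairing_sub_extPairing_le`).

**Packing.** By scaling, every `δ`-non-LCV cube `Q` carries a bump `φ_Q` at scale `ℓ(Q)` with
`|⟨T(φ_Q μ), χ⟩_μ| ≥ Δ ℓ(Q)^s`. These bumps have mean zero and are Lipschitz, hence are almost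
orthogonal: the rows of their Gram matrix are `O(ℓ(Q)^s)`
(`DyadicLattice.exists_sum_norm_integral_le`), which gives a Bessel inequality
(`sum_norm_integral_smul_sq_le`). For `Q ⊆ P` a single cutoff `χ`, equal to `1` on a large multiple
of `P`, serves all `Q`, and the Bessel inequality for `T_{μ,ε} χ`, whose `L²` norm squared is
`O(ℓ(P)^s)`, bounds `∑ ℓ(Q)^s` (`sum_side_pow_le`).
-/

/-! ### Calderón–Zygmund kernels -/

section Kernel

variable {d d' s : ℕ} {α : ℝ} {K : RSpace d → CSpace d'}

/-- The mean value estimate for `x ↦ x ^ p` on `[0, 2a]`. -/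
theorem Real.abs_rpow_sub_rpow_le {p a b : ℝ} (hp : 1 ≤ p) (ha : 0 < a) (hab : |b - a| ≤ a / 2) :
    |b ^ p - a ^ p| ≤ p * 2 ^ p * a ^ (p - 1) * |b - a| := by
  have hb : 0 < b := by
    have := (abs_le.1 hab).1
    linarith
  have hb2 : b ≤ 2 * a := by
    have := (abs_le.1 hab).2
    linarith
  have key := (convex_Icc (0 : ℝ) (2 * a)).norm_image_sub_le_of_norm_hasDerivWithin_le
    (f := fun x => x ^ p) (f' := fun x => p * x ^ (p - 1)) (C := p * (2 * a) ^ (p - 1))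
    (x := a) (y := b)
    (fun x _ => (Real.hasDerivAt_rpow_const (Or.inr hp)).hasDerivWithinAt)
    (fun x hx => by
      rw [Real.norm_eq_abs, abs_of_nonneg (mul_nonneg (by linarith) (Real.rpow_nonneg hx.1 _))]
      have hx1 : x ^ (p - 1) ≤ (2 * a) ^ (p - 1) :=
        Real.rpow_le_rpow hx.1 hx.2 (by linarith)
      gcongr)
    ⟨ha.le, by linarith⟩ ⟨hb.le, hb2⟩
  simp only [Real.norm_eq_abs] at key
  refine key.trans ?_
  have h2 : (2 : ℝ) ^ (p - 1) ≤ 2 ^ p :=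
    Real.rpow_le_rpow_of_exponent_le (by norm_num) (by linarith)
  rw [Real.mul_rpow (by norm_num) ha.le, ← mul_assoc p]
  gcongr

namespace IsCZKernel

theorem continuousOn (hK : IsCZKernel s α K) : ContinuousOn K {0}ᶜ := by
  obtain ⟨C, hC⟩ := hK.holder
  have hG : ContinuousOn (fun x => (‖x‖ ^ ((s : ℝ) + α)) • K x) {0}ᶜ := by
    intro x hx
    rw [ContinuousWithinAt, tendsto_iff_norm_sub_tendsto_zero]
    have h0 : Filter.Tendsto (fun y => C * ‖y - x‖ ^ α) (nhdsWithin x {0}ᶜ) (nhds 0) := by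
      have : ContinuousAt (fun y => C * ‖y - x‖ ^ α) x := by
        exact continuousAt_const.mul
          (ContinuousAt.rpow_const (by fun_prop) (Or.inr hK.alpha_pos.le))
      have h2 := this.tendsto
      simp only [sub_self, norm_zero, Real.zero_rpow hK.alpha_pos.ne', mul_zero] at h2
      exact h2.mono_left nhdsWithin_le_nhds
    refine squeeze_zero' (Filter.Eventually.of_forall fun _ => norm_nonneg _) ?_ h0
    filter_upwards [self_mem_nhdsWithin] with y hy
    exact hC y x hy hx
  have hH : ContinuousOn (fun x : RSpace d => (‖x‖ ^ ((s : ℝ) + α))⁻¹) {0}ᶜ := by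
    intro x hx
    have hx' : 0 < ‖x‖ := norm_pos_iff.2 hx
    refine (ContinuousAt.inv₀ (ContinuousAt.rpow_const (by fun_prop) (Or.inl hx'.ne'))
      (Real.rpow_pos_of_pos hx' _).ne').continuousWithinAt
  refine (hH.smul hG).congr fun x hx => ?_
  have hx' : 0 < ‖x‖ := norm_pos_iff.2 hx
  simp only [Pi.smul_apply']
  rw [smul_smul, inv_mul_cancel₀ (Real.rpow_pos_of_pos hx' _).ne', one_smul]

theorem measurable (hK : IsCZKernel s α K) : Measurable K :=
  measurable_of_continuousOn_compl_singleton 0 hK.continuousOn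

/-- The smoothness of a Calderón–Zygmund kernel away from the origin. -/
theorem norm_sub_le (hs : 0 < s) (hK : IsCZKernel s α K) :
    ∃ C : ℝ, 0 ≤ C ∧ ∀ u v : RSpace d, v ≠ 0 → ‖u - v‖ ≤ ‖v‖ / 2 →
      ‖K u - K v‖ ≤ C * ‖u - v‖ ^ α / ‖v‖ ^ ((s : ℝ) + α) := by
  obtain ⟨C, hC⟩ := hK.holder
  have hα := hK.alpha_pos
  have hα1 := hK.alpha_le_one
  have hs1 : (1 : ℝ) ≤ s := by exact_mod_cast hs
  set p : ℝ := (s : ℝ) + α with hp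
  refine ⟨|C| + p * 2 ^ p * 2 ^ s, by positivity, fun u v hv huv => ?_⟩
  have hv' : 0 < ‖v‖ := norm_pos_iff.2 hv
  have hnn : |‖u‖ - ‖v‖| ≤ ‖u - v‖ := abs_norm_sub_norm_le u v
  have hu' : ‖v‖ / 2 ≤ ‖u‖ := by
    have := (abs_le.1 hnn).1
    linarith
  have hu : u ≠ 0 := norm_pos_iff.1 (by linarith)
  rcases eq_or_ne u v with rfl | hne
  · simp [Real.zero_rpow hα.ne']
  have hh : 0 < ‖u - v‖ := norm_pos_iff.2 (sub_ne_zero.2 hne)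
  rw [le_div_iff₀ (Real.rpow_pos_of_pos hv' _)]
  -- Compare through `‖x‖ ^ p • K x`, which is `α`-Hölder.
  have e1 : ‖K u - K v‖ * ‖v‖ ^ p
      = ‖(‖u‖ ^ p • K u - ‖v‖ ^ p • K v) - (‖u‖ ^ p - ‖v‖ ^ p) • K u‖ := by
    have : (‖u‖ ^ p • K u - ‖v‖ ^ p • K v) - (‖u‖ ^ p - ‖v‖ ^ p) • K u
        = (‖v‖ ^ p) • (K u - K v) := by
      rw [sub_smul, smul_sub]; abel
    rw [this, norm_smul, Real.norm_of_nonneg (Real.rpow_nonneg hv'.le _), mul_comm]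
  have e2 : ‖(‖u‖ ^ p - ‖v‖ ^ p) • K u‖ ≤ p * 2 ^ p * 2 ^ s * ‖u - v‖ ^ α := by
    rw [norm_smul, Real.norm_eq_abs]
    have h1 := Real.abs_rpow_sub_rpow_le (p := p) (by linarith) hv' (hnn.trans huv)
    have h2 : ‖K u‖ ≤ 2 ^ s / ‖v‖ ^ s := by
      refine (hK.bound u hu).trans ?_
      rw [div_le_div_iff₀ (by positivity) (by positivity), one_mul, ← mul_pow]
      gcongr
      linarith
    -- `‖v‖ ^ (α - 1) ≤ ‖u - v‖ ^ (α - 1)`, because `α ≤ 1` and `‖u - v‖ ≤ ‖v‖`.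
    have h3 : ‖v‖ ^ (p - 1) * ‖u - v‖ * (1 / ‖v‖ ^ s) ≤ ‖u - v‖ ^ α := by
      have h4 : ‖v‖ ^ (p - 1) * (1 / ‖v‖ ^ s) = ‖v‖ ^ (α - 1) := by
        rw [← Real.rpow_natCast, one_div, ← Real.rpow_neg hv'.le, ← Real.rpow_add hv']
        congr 1; rw [hp]; ring
      have h5 : ‖v‖ ^ (α - 1) ≤ ‖u - v‖ ^ (α - 1) :=
        Real.rpow_le_rpow_of_nonpos hh (by linarith) (by linarith)
      calc ‖v‖ ^ (p - 1) * ‖u - v‖ * (1 / ‖v‖ ^ s)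
          = ‖v‖ ^ (α - 1) * ‖u - v‖ := by rw [← h4]; ring
        _ ≤ ‖u - v‖ ^ (α - 1) * ‖u - v‖ := by gcongr
        _ = ‖u - v‖ ^ α := by
          rw [← Real.rpow_add_one hh.ne']; congr 1; ring
    calc |‖u‖ ^ p - ‖v‖ ^ p| * ‖K u‖
        ≤ (p * 2 ^ p * ‖v‖ ^ (p - 1) * ‖u - v‖) * (2 ^ s / ‖v‖ ^ s) := by
          gcongr
          refine h1.trans ?_
          gcongr
      _ = p * 2 ^ p * 2 ^ s * (‖v‖ ^ (p - 1) * ‖u - v‖ * (1 / ‖v‖ ^ s)) := by ring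
      _ ≤ _ := by gcongr
  rw [e1, add_mul]
  refine (_root_.norm_sub_le _ _).trans (add_le_add ?_ e2)
  refine (hC u v hu hv).trans ?_
  gcongr
  exact le_abs_self C

theorem regKernel_eq_self {δ : ℝ} {x : RSpace d} (hx : δ ≤ ‖x‖) (hx0 : x ≠ 0) :
    regKernel s α K δ x = K x := by
  have hx' : 0 < ‖x‖ := norm_pos_iff.2 hx0
  rw [regKernel, max_eq_left hx, div_self hx'.ne', Real.one_rpow, one_smul]

theorem norm_regKernel_le (hK : IsCZKernel s α K) (δ : ℝ) (x : RSpace d) :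
    ‖regKernel s α K δ x‖ ≤ ‖K x‖ := by
  have h1 : (‖x‖ / max ‖x‖ δ) ^ ((s : ℝ) + α) ≤ 1 := by
    have := hK.alpha_pos
    refine Real.rpow_le_one (by positivity) ?_ (by positivity)
    exact div_le_one_of_le₀ (le_max_left _ _) (by positivity)
  rw [regKernel, norm_smul, Real.norm_of_nonneg (by positivity)]
  exact mul_le_of_le_one_left (norm_nonneg _) h1

theorem regKernel_zero (hK : IsCZKernel s α K) (δ : ℝ) : regKernel s α K δ 0 = 0 := by
  have := hK.alpha_pos
  rw [regKernel, norm_zero, zero_div, Real.zero_rpow (by positivity), zero_smul]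

theorem regKernel_neg (hK : IsCZKernel s α K) (δ : ℝ) (x : RSpace d) :
    regKernel s α K δ (-x) = -regKernel s α K δ x := by
  rcases eq_or_ne x 0 with rfl | hx
  · simp [hK.regKernel_zero]
  · simp [regKernel, hK.odd x hx]

theorem norm_regKernel_le_div (hK : IsCZKernel s α K) {δ : ℝ} (hδ : 0 < δ) (x : RSpace d) :
    ‖regKernel s α K δ x‖ ≤ ‖x‖ ^ α / δ ^ ((s : ℝ) + α) := by
  have hα := hK.alpha_pos
  rcases eq_or_ne x 0 with rfl | hx
  · rw [hK.regKernel_zero, norm_zero]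
    positivity
  have hx' : 0 < ‖x‖ := norm_pos_iff.2 hx
  rw [regKernel, norm_smul, Real.norm_of_nonneg (by positivity),
    Real.div_rpow hx'.le (by positivity), Real.rpow_add hx', Real.rpow_natCast]
  calc _ ≤ ‖x‖ ^ s * ‖x‖ ^ α / (max ‖x‖ δ) ^ ((s : ℝ) + α) * (1 / ‖x‖ ^ s) := by
        gcongr; exact hK.bound x hx
    _ = ‖x‖ ^ α / (max ‖x‖ δ) ^ ((s : ℝ) + α) := by field_simp
    _ ≤ _ := by gcongr; exact le_max_right _ _

theorem continuous_regKernel (hK : IsCZKernel s α K) {δ : ℝ} (hδ : 0 < δ) :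
    Continuous (regKernel s α K δ) := by
  rw [continuous_iff_continuousAt]
  intro x
  have hα := hK.alpha_pos
  rcases eq_or_ne x 0 with rfl | hx
  · rw [ContinuousAt, hK.regKernel_zero]
    refine squeeze_zero_norm (hK.norm_regKernel_le_div hδ) ?_
    have : ContinuousAt (fun x : RSpace d => ‖x‖ ^ α / δ ^ ((s : ℝ) + α)) 0 :=
      (ContinuousAt.rpow_const (by fun_prop) (Or.inr hα.le)).div_const _
    simpa [ContinuousAt, Real.zero_rpow hα.ne'] using this
  · have h1 : ContinuousAt K x := hK.continuousOn.continuousAt (isOpen_compl_singleton.mem_nhds hx)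
    refine ContinuousAt.smul (ContinuousAt.rpow_const ?_ (Or.inr (by positivity))) h1
    refine ContinuousAt.div (by fun_prop) (by fun_prop) ?_
    have := lt_of_lt_of_le hδ (le_max_right ‖x‖ δ)
    exact this.ne'

end IsCZKernel

end Kernel

/-! ### Integral estimates for measures of polynomial growth -/

section Growth

variable {d s : ℕ} {Λ : ℝ} {μ : Measure (RSpace d)}

namespace IsNiceWith

theorem measure_singleton (hs : 0 < s) (hμ : IsNiceWith s Λ μ) (x : RSpace d) : μ {x} = 0 := by
  have h1 : Filter.Tendsto (fun r : ℝ => ENNReal.ofReal (Λ * r ^ s)) (nhdsWithin 0 (Set.Ioi 0))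
      (nhds 0) := by
    have : Continuous (fun r : ℝ => ENNReal.ofReal (Λ * r ^ s)) :=
      ENNReal.continuous_ofReal.comp (by fun_prop)
    have h2 := this.tendsto 0
    simp only [zero_pow hs.ne', mul_zero, ENNReal.ofReal_zero] at h2
    exact h2.mono_left nhdsWithin_le_nhds
  refine le_antisymm (ge_of_tendsto h1 ?_) bot_le
  filter_upwards [self_mem_nhdsWithin] with r hr
  exact (measure_mono (by simpa using hr)).trans (hμ x r hr)

theorem lintegral_annulus_le (hμ : IsNiceWith s Λ μ) (x : RSpace d) {a p : ℝ}
    (ha : 0 < a) (hp : 0 ≤ p) :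
    ∫⁻ y in {y | a ≤ ‖x - y‖ ∧ ‖x - y‖ ≤ 2 * a}, (‖x - y‖ₑ ^ p)⁻¹ ∂μ
      ≤ ENNReal.ofReal (Λ * 3 ^ s * a ^ ((s : ℝ) - p)) := by
  have hm : MeasurableSet {y : RSpace d | a ≤ ‖x - y‖ ∧ ‖x - y‖ ≤ 2 * a} := by
    have h1 : Measurable fun y : RSpace d => ‖x - y‖ := by fun_prop
    exact (measurableSet_le measurable_const h1).inter (measurableSet_le h1 measurable_const)
  calc ∫⁻ y in {y | a ≤ ‖x - y‖ ∧ ‖x - y‖ ≤ 2 * a}, (‖x - y‖ₑ ^ p)⁻¹ ∂μ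
      ≤ ∫⁻ y in {y | a ≤ ‖x - y‖ ∧ ‖x - y‖ ≤ 2 * a}, ENNReal.ofReal (a ^ (-p)) ∂μ := by
        refine setLIntegral_mono' hm fun y hy => ?_
        rw [Real.rpow_neg ha.le, ENNReal.ofReal_inv_of_pos (Real.rpow_pos_of_pos ha _),
          ← ENNReal.ofReal_rpow_of_pos ha, ← ofReal_norm]
        gcongr
        exact hy.1
    _ ≤ ENNReal.ofReal (a ^ (-p)) * ENNReal.ofReal (Λ * (3 * a) ^ s) := by
        rw [setLIntegral_const]
        gcongr
        refine (measure_mono ?_).trans (hμ x (3 * a) (by positivity))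
        intro y hy
        rw [Metric.mem_ball, dist_comm, dist_eq_norm]
        exact hy.2.trans_lt (by linarith)
    _ = _ := by
        rw [← ENNReal.ofReal_mul (by positivity), sub_eq_add_neg, Real.rpow_add ha,
          Real.rpow_natCast, mul_pow]
        congr 1; ring

theorem lintegral_iUnion_annulus_le (hμ : IsNiceWith s Λ μ) (hΛ : 0 ≤ Λ) (x : RSpace d) {a : ℕ → ℝ}
    {p S : ℝ} (ha : ∀ j, 0 < a j) (hp : 0 ≤ p) (hS : HasSum (fun j => (a j) ^ ((s : ℝ) - p)) S) :
    ∫⁻ y in ⋃ j, {y | a j ≤ ‖x - y‖ ∧ ‖x - y‖ ≤ 2 * a j}, (‖x - y‖ₑ ^ p)⁻¹ ∂μ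
      ≤ ENNReal.ofReal (Λ * 3 ^ s * S) := by
  refine (lintegral_iUnion_le _ _).trans ?_
  refine (ENNReal.tsum_le_tsum fun j => hμ.lintegral_annulus_le x (ha j) hp).trans ?_
  have h := hS.mul_left (Λ * 3 ^ s)
  rw [← ENNReal.ofReal_tsum_of_nonneg (fun j => ?_) h.summable, h.tsum_eq]
  have := Real.rpow_nonneg (ha j).le ((s : ℝ) - p)
  positivity

/-- The local potential bound: sum over the dyadic annuli of radii `r 2^(-j-1)` to `r 2^(-j)`. -/
theorem lintegral_ball_le (hs : 0 < s) (hμ : IsNiceWith s Λ μ) (hΛ : 0 ≤ Λ) (x : RSpace d) {r : ℝ}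
    (hr : 0 < r) :
    ∫⁻ y in Metric.ball x r, (‖x - y‖ₑ ^ ((s : ℝ) - 1))⁻¹ ∂μ
      ≤ ENNReal.ofReal (Λ * 3 ^ s * r) := by
  have hs1 : (1 : ℝ) ≤ s := by exact_mod_cast hs
  have hsum : HasSum (fun j : ℕ => (r * (1 / 2) ^ (j + 1)) ^ ((s : ℝ) - (s - 1))) r := by
    have h2 : (fun j : ℕ => (r * (1 / 2) ^ (j + 1)) ^ ((s : ℝ) - (s - 1)))
        = fun j : ℕ => r / 2 / 2 ^ j := by
      funext j
      rw [sub_sub_cancel, Real.rpow_one, pow_succ, one_div, inv_pow]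
      field_simp
    rw [h2]
    exact hasSum_geometric_two' r
  have key := hμ.lintegral_iUnion_annulus_le hΛ x (a := fun j => r * (1 / 2) ^ (j + 1))
    (p := (s : ℝ) - 1) (fun j => by positivity) (by linarith) hsum
  refine le_trans ?_ key
  have hsub : Metric.ball x r ⊆ {x} ∪
      ⋃ j : ℕ, {y | r * (1 / 2) ^ (j + 1) ≤ ‖x - y‖ ∧ ‖x - y‖ ≤ 2 * (r * (1 / 2) ^ (j + 1))} := by
    intro y hy
    rcases eq_or_ne y x with rfl | hne
    · exact Or.inl rfl
    right
    rw [Metric.mem_ball, dist_comm, dist_eq_norm] at hy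
    have h0 : 0 < ‖x - y‖ := norm_pos_iff.2 (sub_ne_zero.2 hne.symm)
    obtain ⟨n, h1, h2⟩ := exists_nat_pow_near_of_lt_one (x := ‖x - y‖ / r) (y := (1 / 2 : ℝ))
      (by positivity) ((div_le_one hr).2 hy.le) (by norm_num) (by norm_num)
    rw [lt_div_iff₀ hr] at h1
    rw [div_le_iff₀ hr] at h2
    refine Set.mem_iUnion.2 ⟨n, by linarith, h2.trans (le_of_eq ?_)⟩
    rw [pow_succ]; ring
  -- The centre itself carries no mass, whatever the value of the integrand there.
  refine (lintegral_mono_set hsub).trans ((lintegral_union_le _ _ _).trans ?_)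
  rw [setLIntegral_measure_zero _ _ (hμ.measure_singleton hs x), zero_add]

/-- The tail of `∫ |x|^(-s-α) dμ` decays like `N^(-α)`. -/
theorem lintegral_compl_ball_le (hμ : IsNiceWith s Λ μ) (hΛ : 0 ≤ Λ) {α : ℝ} (hα : 0 < α) {N : ℝ}
    (hN : 0 < N) :
    ∫⁻ x in {x : RSpace d | N ≤ ‖x‖}, (‖x‖ₑ ^ ((s : ℝ) + α))⁻¹ ∂μ
      ≤ ENNReal.ofReal (Λ * 3 ^ s * (1 - 2 ^ (-α))⁻¹ * N ^ (-α)) := by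
  have hsum : HasSum (fun j : ℕ => (N * 2 ^ j) ^ ((s : ℝ) - (s + α)))
      ((1 - 2 ^ (-α))⁻¹ * N ^ (-α)) := by
    have h2 : (fun j : ℕ => (N * 2 ^ j) ^ ((s : ℝ) - (s + α)))
        = fun j : ℕ => ((2 : ℝ) ^ (-α)) ^ j * N ^ (-α) := by
      funext j
      rw [sub_add_cancel_left, Real.mul_rpow hN.le (by positivity), mul_comm,
        ← Real.rpow_natCast, ← Real.rpow_natCast, ← Real.rpow_mul (by norm_num),
        ← Real.rpow_mul (by norm_num), mul_comm (j : ℝ)]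
    rw [h2]
    refine (hasSum_geometric_of_lt_one (by positivity) ?_).mul_right _
    exact Real.rpow_lt_one_of_one_lt_of_neg (by norm_num) (by linarith)
  have key := hμ.lintegral_iUnion_annulus_le hΛ 0 (a := fun j => N * 2 ^ j)
    (p := (s : ℝ) + α) (fun j => by positivity) (by positivity) hsum
  simp only [zero_sub, norm_neg, enorm_neg] at key
  rw [mul_assoc (Λ * 3 ^ s)]
  refine le_trans (lintegral_mono_set fun x hx => ?_) key
  have hx' : N ≤ ‖x‖ := hx
  obtain ⟨n, h1, h2⟩ := exists_nat_pow_near (x := ‖x‖ / N) (y := (2 : ℝ))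
    ((one_le_div hN).2 hx') (by norm_num)
  rw [le_div_iff₀ hN] at h1
  rw [div_lt_iff₀ hN] at h2
  refine Set.mem_iUnion.2 ⟨n, by linarith, h2.le.trans (le_of_eq ?_)⟩
  rw [pow_succ]; ring

theorem hasRestrictedGrowth (hμ : IsNiceWith s Λ μ) (hΛ : 0 ≤ Λ) {α : ℝ} (hα : 0 < α) :
    HasRestrictedGrowth s α μ :=
  (hμ.lintegral_compl_ball_le hΛ hα one_pos).trans_lt ENNReal.ofReal_lt_top

/-- The contribution of a neighbourhood of the diagonal of width `ε` to the local energy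
`∬ |x-y|^(1-s) dμ dμ` is `O(ε)`. -/
theorem lintegral_near_diagonal_le [SFinite μ] (hs : 0 < s) (hμ : IsNiceWith s Λ μ) (hΛ : 0 ≤ Λ)
    {R ε : ℝ} (hR : 0 < R) (hε : 0 < ε) :
    ∫⁻ z in {z | z.1 ∈ Metric.ball (0 : RSpace d) R ∧ ‖z.1 - z.2‖ < ε},
      (‖z.1 - z.2‖ₑ ^ ((s : ℝ) - 1))⁻¹ ∂(μ.prod μ) ≤
      ENNReal.ofReal (Λ * 3 ^ s * ε * (Λ * R ^ s)) := by
  have hm : MeasurableSet {z : RSpace d × RSpace d | z.1 ∈ Metric.ball (0 : RSpace d) R ∧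
      ‖z.1 - z.2‖ < ε} := by
    have h1 : Measurable fun z : RSpace d × RSpace d => ‖z.1 - z.2‖ := by fun_prop
    exact (measurable_fst Metric.isOpen_ball.measurableSet).inter
      (measurableSet_lt h1 measurable_const)
  rw [← lintegral_indicator hm, lintegral_prod]
  swap
  · refine (Measurable.indicator ?_ hm).aemeasurable
    fun_prop
  calc _ = ∫⁻ x, (Metric.ball (0 : RSpace d) R).indicator
          (fun x => ∫⁻ y in Metric.ball x ε, (‖x - y‖ₑ ^ ((s : ℝ) - 1))⁻¹ ∂μ) x ∂μ := by
        refine lintegral_congr fun x => ?_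
        by_cases hx : x ∈ Metric.ball (0 : RSpace d) R
        · rw [Set.indicator_of_mem hx, ← lintegral_indicator Metric.isOpen_ball.measurableSet]
          refine lintegral_congr fun y => ?_
          have hx' : dist x 0 < R := Metric.mem_ball.1 hx
          simp only [Set.indicator, Set.mem_ofPred_eq, hx', true_and,
            Metric.mem_ball, dist_comm y x, dist_eq_norm x y]
        · simp [Set.indicator, hx, -Metric.mem_ball]
    _ ≤ ∫⁻ x in Metric.ball (0 : RSpace d) R, ENNReal.ofReal (Λ * 3 ^ s * ε) ∂μ := by
        rw [lintegral_indicator Metric.isOpen_ball.measurableSet]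
        exact lintegral_mono fun x => hμ.lintegral_ball_le hs hΛ x hε
    _ ≤ _ := by
        rw [setLIntegral_const, ENNReal.ofReal_mul (p := Λ * 3 ^ s * ε) (by positivity)]
        gcongr
        exact hμ 0 R hR

theorem isDiffuse [SFinite μ] (hs : 0 < s) (hμ : IsNiceWith s Λ μ) (hΛ : 0 ≤ Λ) :
    IsDiffuse s μ := by
  intro R
  rcases le_or_gt R 0 with hR | hR
  · simp [Metric.ball_eq_empty.2 hR]
  refine lt_of_le_of_lt (lintegral_mono_set ?_)
    ((hμ.lintegral_near_diagonal_le hs hΛ hR (by positivity : 0 < 2 * R)).trans_lt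
      ENNReal.ofReal_lt_top)
  rintro ⟨x, y⟩ ⟨hx, hy⟩
  refine ⟨hx, ?_⟩
  simp only [mem_ball_zero_iff] at hx hy
  exact (norm_sub_le x y).trans_lt (by linarith)

end IsNiceWith

end Growth

/-! ### The bilinear form on Lipschitz functions -/

section Pairing

variable {d d' s : ℕ} {α Λ : ℝ} {K : RSpace d → CSpace d'} {μ : Measure (RSpace d)}

/-- A quantitative form of `IsLipZero`: `f` has Lipschitz constant `L`, is bounded by `A`, and
vanishes outside the open ball `B(0,R)`. -/
structure IsLipBump (L A R : ℝ) (f : RSpace d → ℂ) : Prop where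
  lip : ∀ x y, ‖f x - f y‖ ≤ L * ‖x - y‖
  bound : ∀ x, ‖f x‖ ≤ A
  eq_zero : ∀ x, R ≤ ‖x‖ → f x = 0

namespace IsLipBump

variable {L A R L' A' R' : ℝ} {f g φ : RSpace d → ℂ}

theorem bound_nonneg (hf : IsLipBump L A R f) : 0 ≤ A := (norm_nonneg _).trans (hf.bound 0)

theorem continuous (hf : IsLipBump L A R f) : Continuous f := by
  refine (LipschitzWith.of_dist_le_mul (K := L.toNNReal) fun x y => ?_).continuous
  rw [dist_eq_norm, dist_eq_norm]
  refine (hf.lip x y).trans ?_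
  gcongr
  exact Real.le_coe_toNNReal L

theorem hasCompactSupport (hf : IsLipBump L A R f) : HasCompactSupport f := by
  refine HasCompactSupport.intro (isCompact_closedBall (0 : RSpace d) R) fun x hx => ?_
  rw [mem_closedBall_zero_iff, not_le] at hx
  exact hf.eq_zero x hx.le

theorem isLipZero (hf : IsLipBump L A R f) : IsLipZero f := by
  refine ⟨⟨L.toNNReal, LipschitzWith.of_dist_le_mul fun x y => ?_⟩, hf.hasCompactSupport⟩
  rw [dist_eq_norm, dist_eq_norm]
  refine (hf.lip x y).trans ?_
  gcongr
  exact Real.le_coe_toNNReal L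

theorem integrable [IsLocallyFiniteMeasure μ] (hf : IsLipBump L A R f) : Integrable f μ :=
  hf.continuous.integrable_of_hasCompactSupport hf.hasCompactSupport

theorem mono (hf : IsLipBump L A R f)
    (hL : L ≤ L') (hA : A ≤ A') : IsLipBump L' A' R f :=
  ⟨fun x y => (hf.lip x y).trans (by gcongr), fun x => (hf.bound x).trans hA, hf.eq_zero⟩

theorem mono_radius (hf : IsLipBump L A R f) (h : R ≤ R') : IsLipBump L A R' f :=
  ⟨hf.lip, hf.bound, fun x hx => hf.eq_zero x (h.trans hx)⟩

theorem add (hf : IsLipBump L A R f) (hg : IsLipBump L' A' R g) :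
    IsLipBump (L + L') (A + A') R (fun x => f x + g x) where
  lip x y := by
    rw [add_sub_add_comm, add_mul]
    exact (norm_add_le _ _).trans (add_le_add (hf.lip x y) (hg.lip x y))
  bound x := (norm_add_le _ _).trans (add_le_add (hf.bound x) (hg.bound x))
  eq_zero x hx := by rw [hf.eq_zero x hx, hg.eq_zero x hx, add_zero]

theorem const_mul (hf : IsLipBump L A R f) (c : ℂ) :
    IsLipBump (‖c‖ * L) (‖c‖ * A) R (fun x => c * f x) where
  lip x y := by
    rw [← mul_sub, norm_mul, mul_assoc]
    exact mul_le_mul_of_nonneg_left (hf.lip x y) (norm_nonneg c)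
  bound x := by
    rw [norm_mul]
    exact mul_le_mul_of_nonneg_left (hf.bound x) (norm_nonneg c)
  eq_zero x hx := by rw [hf.eq_zero x hx, mul_zero]

end IsLipBump

theorem IsLipZero.exists_isLipBump {f : RSpace d → ℂ} (hf : IsLipZero f) :
    ∃ L A R : ℝ, 0 ≤ L ∧ 0 < R ∧ IsLipBump L A R f := by
  obtain ⟨⟨L, hL⟩, hc⟩ := hf
  obtain ⟨A, hA⟩ := hc.exists_bound_of_continuous hL.continuous
  obtain ⟨R, hR⟩ := hc.isBounded.subset_ball (0 : RSpace d)
  refine ⟨L, A, max R 1, L.2, by positivity, fun x y => ?_, hA, fun x hx => ?_⟩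
  · rw [← dist_eq_norm, ← dist_eq_norm]
    exact hL.dist_le_mul x y
  · refine image_eq_zero_of_notMem_tsupport fun h => ?_
    have := mem_ball_zero_iff.1 (hR h)
    exact absurd ((le_max_left _ _).trans hx) (not_le.2 this)

/-- The antisymmetrized product `H_{f,φ}(x,y) = (f(y) φ(x) - φ(y) f(x)) / 2`. -/
noncomputable def altProd (f φ : RSpace d → ℂ) (z : RSpace d × RSpace d) : ℂ :=
  (1 / 2 : ℂ) * (f z.2 * φ z.1 - φ z.2 * f z.1)

theorem lipPairing_def (k : RSpace d → CSpace d') (μ : Measure (RSpace d)) (f φ : RSpace d → ℂ) :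
    lipPairing k μ f φ = ∫ z, altProd f φ z • k (z.1 - z.2) ∂(μ.prod μ) := rfl

namespace IsLipBump

variable {L A R L' A' : ℝ} {f φ : RSpace d → ℂ}

theorem norm_altProd_le (hf : IsLipBump L A R f) (hφ : IsLipBump L' A' R φ)
    (z : RSpace d × RSpace d) : ‖altProd f φ z‖ ≤ (A * L' + A' * L) * ‖z.1 - z.2‖ := by
  have e : f z.2 * φ z.1 - φ z.2 * f z.1
      = f z.2 * (φ z.1 - φ z.2) - φ z.2 * (f z.1 - f z.2) := by ring
  have hA := hf.bound_nonneg
  have hA' := hφ.bound_nonneg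
  have h1 : ‖f z.2 * φ z.1 - φ z.2 * f z.1‖ ≤ (A * L' + A' * L) * ‖z.1 - z.2‖ := by
    rw [e]
    refine (norm_sub_le _ _).trans ?_
    rw [norm_mul, norm_mul, add_mul, mul_assoc, mul_assoc]
    gcongr
    · exact hf.bound _
    · exact hφ.lip _ _
    · exact hφ.bound _
    · exact hf.lip _ _
  rw [altProd, norm_mul]
  refine le_trans ?_ h1
  refine mul_le_of_le_one_left (norm_nonneg _) ?_
  norm_num

theorem altProd_eq_zero (hf : IsLipBump L A R f) (hφ : IsLipBump L' A' R φ)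
    {z : RSpace d × RSpace d} (hz : R ≤ ‖z.1‖ ∨ R ≤ ‖z.2‖) : altProd f φ z = 0 := by
  rcases hz with hz | hz <;> simp [altProd, hf.eq_zero _ hz, hφ.eq_zero _ hz]

theorem continuous_altProd (hf : IsLipBump L A R f) (hφ : IsLipBump L' A' R φ) :
    Continuous (altProd f φ) := by
  have := hf.continuous
  have := hφ.continuous
  unfold altProd
  fun_prop

/-- The singularity of the kernel is compensated up to order `s - 1` by the antisymmetrization. -/
theorem enorm_pairing_le (hf : IsLipBump L A R f) (hφ : IsLipBump L' A' R φ)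
    (hL : 0 ≤ L) (hL' : 0 ≤ L') {k : RSpace d → CSpace d'}
    (hk : ∀ x, x ≠ 0 → ‖k x‖ ≤ 1 / ‖x‖ ^ s) (z : RSpace d × RSpace d) :
    ‖altProd f φ z • k (z.1 - z.2)‖ₑ
      ≤ ENNReal.ofReal (A * L' + A' * L) * (‖z.1 - z.2‖ₑ ^ ((s : ℝ) - 1))⁻¹ := by
  have hA := hf.bound_nonneg
  have hA' := hφ.bound_nonneg
  have h1 := hf.norm_altProd_le hφ z
  rcases eq_or_ne z.1 z.2 with h | h
  · rw [h, sub_self, norm_zero, mul_zero] at h1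
    rw [norm_le_zero_iff.1 h1]
    simp
  have h0 : z.1 - z.2 ≠ 0 := sub_ne_zero.2 h
  have ht : 0 < ‖z.1 - z.2‖ := norm_pos_iff.2 h0
  rw [← ofReal_norm (z.1 - z.2), ENNReal.ofReal_rpow_of_pos ht,
    ← ENNReal.ofReal_inv_of_pos (Real.rpow_pos_of_pos ht _), ← ENNReal.ofReal_mul (by positivity),
    ← ofReal_norm]
  refine ENNReal.ofReal_le_ofReal ?_
  rw [norm_smul]
  calc _ ≤ (A * L' + A' * L) * ‖z.1 - z.2‖ * (1 / ‖z.1 - z.2‖ ^ s) := by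
        gcongr; exact hk _ h0
    _ = _ := by
        rw [Real.rpow_sub ht, Real.rpow_natCast, Real.rpow_one]
        field_simp

end IsLipBump

section Integrability

variable {L A R L' A' : ℝ} {f g φ : RSpace d → ℂ}

theorem aestronglyMeasurable_pairing [SFinite μ] (hf : IsLipBump L A R f)
    (hφ : IsLipBump L' A' R φ) {k : RSpace d → CSpace d'} (hkm : Measurable k) :
    AEStronglyMeasurable (fun z : RSpace d × RSpace d => altProd f φ z • k (z.1 - z.2))
      (μ.prod μ) := by
  have h1 := (hf.continuous_altProd hφ).measurable
  exact (h1.smul (hkm.comp (measurable_fst.sub measurable_snd))).aestronglyMeasurable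

theorem integrable_pairing [SFinite μ] (hs : 0 < s) (hμ : IsNiceWith s Λ μ) (hΛ : 0 ≤ Λ)
    (hf : IsLipBump L A R f) (hφ : IsLipBump L' A' R φ) (hL : 0 ≤ L) (hL' : 0 ≤ L') (hR : 0 < R)
    {k : RSpace d → CSpace d'} (hkm : Measurable k) (hk : ∀ x, x ≠ 0 → ‖k x‖ ≤ 1 / ‖x‖ ^ s) :
    Integrable (fun z : RSpace d × RSpace d => altProd f φ z • k (z.1 - z.2)) (μ.prod μ) := by
  refine ⟨aestronglyMeasurable_pairing hf hφ hkm, ?_⟩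
  set S := {z : RSpace d × RSpace d | z.1 ∈ Metric.ball (0 : RSpace d) R ∧ ‖z.1 - z.2‖ < 2 * R}
  have hz : ∀ z ∉ S, ‖altProd f φ z • k (z.1 - z.2)‖ₑ = 0 := by
    intro z hzS
    have : R ≤ ‖z.1‖ ∨ R ≤ ‖z.2‖ := by
      by_contra! hc
      refine hzS ⟨by simpa using hc.1, ?_⟩
      exact (norm_sub_le _ _).trans_lt (by linarith)
    rw [hf.altProd_eq_zero hφ this]
    simp
  rw [HasFiniteIntegral, ← setLIntegral_eq_of_support_subset (s := S)]
  · refine lt_of_le_of_lt (lintegral_mono fun z => hf.enorm_pairing_le hφ hL hL' hk z) ?_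
    rw [lintegral_const_mul' _ _ ENNReal.ofReal_ne_top]
    exact ENNReal.mul_lt_top ENNReal.ofReal_lt_top
      ((hμ.lintegral_near_diagonal_le hs hΛ hR (by positivity)).trans_lt ENNReal.ofReal_lt_top)
  · intro z hz'
    by_contra hc
    exact hz' (hz z hc)

theorem lipPairing_add_right [SFinite μ] (hs : 0 < s) (hμ : IsNiceWith s Λ μ) (hΛ : 0 ≤ Λ)
    (hf : IsLipBump L A R f) (hφ : IsLipBump L' A' R φ) {L₂ A₂ : ℝ} (hg : IsLipBump L₂ A₂ R g)
    (hL : 0 ≤ L) (hL' : 0 ≤ L') (hL₂ : 0 ≤ L₂) (hR : 0 < R)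
    {k : RSpace d → CSpace d'} (hkm : Measurable k) (hk : ∀ x, x ≠ 0 → ‖k x‖ ≤ 1 / ‖x‖ ^ s) :
    lipPairing k μ f (fun x => φ x + g x) = lipPairing k μ f φ + lipPairing k μ f g := by
  simp only [lipPairing_def]
  rw [← integral_add (integrable_pairing hs hμ hΛ hf hφ hL hL' hR hkm hk)
    (integrable_pairing hs hμ hΛ hf hg hL hL₂ hR hkm hk)]
  refine integral_congr_ae (Filter.Eventually.of_forall fun z => ?_)
  simp only [altProd]
  rw [← add_smul]
  congr 1; ring

theorem lipPairing_const_mul_right (k : RSpace d → CSpace d') (μ : Measure (RSpace d)) (c : ℂ)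
    (f φ : RSpace d → ℂ) :
    lipPairing k μ f (fun x => c * φ x) = c • lipPairing k μ f φ := by
  simp only [lipPairing_def]
  rw [← integral_smul]
  refine integral_congr_ae (Filter.Eventually.of_forall fun z => ?_)
  simp only [altProd]
  rw [smul_smul]
  congr 1; ring

theorem lipPairing_swap (k : RSpace d → CSpace d') (μ : Measure (RSpace d)) (f φ : RSpace d → ℂ) :
    lipPairing k μ φ f = -lipPairing k μ f φ := by
  simp only [lipPairing_def]
  rw [← integral_neg]
  refine integral_congr_ae (Filter.Eventually.of_forall fun z => ?_)
  simp only [altProd]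
  rw [← neg_smul]
  congr 1; ring

theorem lipPairing_add_const_mul_left {μ : Measure (RSpace d)} [SFinite μ] (hs : 0 < s)
    (hK : IsCZKernel s α K) (hμ : IsNiceWith s Λ μ) (hΛ : 0 ≤ Λ) {L A L₁ A₁ L₂ A₂ R : ℝ}
    {f η φ : RSpace d → ℂ} (hf : IsLipBump L A R f) (hη : IsLipBump L₁ A₁ R η)
    (hφ : IsLipBump L₂ A₂ R φ) (hL : 0 ≤ L) (hL₁ : 0 ≤ L₁) (hL₂ : 0 ≤ L₂) (hR : 0 < R) (c : ℂ) :
    lipPairing K μ (fun x => f x + c * η x) φ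
      = lipPairing K μ f φ + c • lipPairing K μ η φ := by
  rw [lipPairing_swap K μ φ, lipPairing_add_right hs hμ hΛ hφ hf (hη.const_mul c) hL₂ hL
    (by positivity) hR hK.measurable hK.bound, lipPairing_const_mul_right, lipPairing_swap K μ f φ,
    lipPairing_swap K μ η φ, smul_neg]
  abel

theorem lipPairing_const_mul_left (k : RSpace d → CSpace d') (μ : Measure (RSpace d)) (c : ℂ)
    (f φ : RSpace d → ℂ) :
    lipPairing k μ (fun x => c * f x) φ = c • lipPairing k μ f φ := by
  rw [lipPairing_swap k μ φ, lipPairing_const_mul_right, lipPairing_swap k μ f φ, smul_neg, neg_neg]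

/-- Truncating the kernel at scale `ε` changes the bilinear form by `O(ε)`. -/
theorem norm_lipPairing_sub_regKernel_le [SFinite μ] (hs : 0 < s) (hK : IsCZKernel s α K)
    (hμ : IsNiceWith s Λ μ) (hΛ : 0 ≤ Λ)
    (hf : IsLipBump L A R f) (hφ : IsLipBump L' A' R φ) (hL : 0 ≤ L) (hL' : 0 ≤ L') (hR : 0 < R)
    {ε : ℝ} (hε : 0 < ε) :
    ‖lipPairing K μ f φ - lipPairing (regKernel s α K ε) μ f φ‖
      ≤ 2 * (A * L' + A' * L) * (Λ * 3 ^ s * ε * (Λ * R ^ s)) := by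
  have hA := hf.bound_nonneg
  have hA' := hφ.bound_nonneg
  have hk' : ∀ x : RSpace d, x ≠ 0 → ‖regKernel s α K ε x‖ ≤ 1 / ‖x‖ ^ s :=
    fun x hx => (hK.norm_regKernel_le ε x).trans (hK.bound x hx)
  have hkm' := (hK.continuous_regKernel hε).measurable
  have i1 := integrable_pairing hs hμ hΛ hf hφ hL hL' hR hK.measurable hK.bound
  have i2 := integrable_pairing hs hμ hΛ hf hφ hL hL' hR hkm' hk'
  simp only [lipPairing_def]
  rw [← integral_sub i1 i2, ← ENNReal.ofReal_le_ofReal_iff (by positivity), ofReal_norm]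
  refine (enorm_integral_le_lintegral_enorm _).trans ?_
  set S := {z : RSpace d × RSpace d | z.1 ∈ Metric.ball (0 : RSpace d) R ∧ ‖z.1 - z.2‖ < ε}
  rw [← setLIntegral_eq_of_support_subset (s := S)]
  · refine (lintegral_mono (g := fun z => ENNReal.ofReal (2 * (A * L' + A' * L)) *
      (‖z.1 - z.2‖ₑ ^ ((s : ℝ) - 1))⁻¹) fun z => ?_).trans ?_
    · refine enorm_sub_le.trans ?_
      beta_reduce
      rw [ENNReal.ofReal_mul (by norm_num), mul_assoc, ENNReal.ofReal_ofNat, two_mul]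
      exact add_le_add (hf.enorm_pairing_le hφ hL hL' hK.bound z)
        (hf.enorm_pairing_le hφ hL hL' hk' z)
    · rw [lintegral_const_mul' _ _ ENNReal.ofReal_ne_top,
        ENNReal.ofReal_mul (p := 2 * (A * L' + A' * L)) (by positivity)]
      gcongr
      exact hμ.lintegral_near_diagonal_le hs hΛ hR hε
  · intro z hz
    by_contra hc
    refine hz ?_
    beta_reduce
    by_cases h1 : z.1 ∈ Metric.ball (0 : RSpace d) R
    · have h2 : ε ≤ ‖z.1 - z.2‖ := not_lt.1 fun h2 => hc ⟨h1, h2⟩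
      rw [IsCZKernel.regKernel_eq_self h2 (norm_pos_iff.1 (hε.trans_le h2))]
      simp
    · rw [hf.altProd_eq_zero hφ (Or.inl (by simpa using h1))]
      simp

end Integrability

end Pairing

/-! ### The pairing with the constant function -/

section Tail

variable {d d' s : ℕ} {α Λ : ℝ} {K : RSpace d → CSpace d'} {μ : Measure (RSpace d)}

section

variable {L A R L' A' : ℝ} {f g : RSpace d → ℂ}

/-- When `f g = 0`, at most one of the two terms of `f(y) g(x) - g(y) f(x)` is non-zero at each
point, so each of them is integrable against the kernel. -/
theorem integrable_mul_smul_of_mul_eq_zero [SFinite μ] (hs : 0 < s) (hK : IsCZKernel s α K)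
    (hμ : IsNiceWith s Λ μ) (hΛ : 0 ≤ Λ) (hf : IsLipBump L A R f) (hg : IsLipBump L' A' R g)
    (hL : 0 ≤ L) (hL' : 0 ≤ L') (hR : 0 < R) (hfg : ∀ x, f x * g x = 0) :
    Integrable (fun z : RSpace d × RSpace d => (f z.2 * g z.1) • K (z.1 - z.2)) (μ.prod μ) := by
  have h := (integrable_pairing hs hμ hΛ hf hg hL hL' hR hK.measurable hK.bound).smul (2 : ℂ)
  refine h.mono ?_ (Filter.Eventually.of_forall fun z => ?_)
  · have h1 := hf.continuous.measurable
    have h2 := hg.continuous.measurable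
    have h3 := hK.measurable
    exact (((h1.comp measurable_snd).mul (h2.comp measurable_fst)).smul
      (h3.comp (measurable_fst.sub measurable_snd))).aestronglyMeasurable
  · by_cases h0 : f z.2 * g z.1 = 0
    · rw [h0, zero_smul, norm_zero]
      exact norm_nonneg _
    · have h1 : f z.1 = 0 := (mul_eq_zero.1 (hfg z.1)).resolve_right (right_ne_zero_of_mul h0)
      refine le_of_eq ?_
      simp only [Pi.smul_apply, altProd, h1, smul_smul]
      congr 2; ring

/-- If `f(y) g(x) k(x-y)` is integrable, the antisymmetrization in the definition of
`⟨T(fμ), g⟩_μ` can be undone. -/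
theorem lipPairing_eq_integral_of_integrable [SFinite μ] {k : RSpace d → CSpace d'}
    (hodd : ∀ x, x ≠ 0 → k (-x) = -k x) (hdiag : ∀ x, (f x * g x) • k 0 = 0)
    (h1 : Integrable (fun z : RSpace d × RSpace d => (f z.2 * g z.1) • k (z.1 - z.2)) (μ.prod μ)) :
    Integrable (fun x => g x • ∫ y, f y • k (x - y) ∂μ) μ ∧
      lipPairing k μ f g = ∫ x, g x • (∫ y, f y • k (x - y) ∂μ) ∂μ := by
  have e1 : ∀ x, ∫ y, (f y * g x) • k (x - y) ∂μ = g x • ∫ y, f y • k (x - y) ∂μ := by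
    intro x
    rw [← integral_smul]
    refine integral_congr_ae (Filter.Eventually.of_forall fun y => ?_)
    simp only [smul_smul, mul_comm]
  have e2 : ∀ z : RSpace d × RSpace d, (g z.2 * f z.1) • k (z.1 - z.2)
      = -((f z.swap.2 * g z.swap.1) • k (z.swap.1 - z.swap.2)) := by
    intro z
    simp only [Prod.fst_swap, Prod.snd_swap]
    by_cases h : z.1 = z.2
    · rw [h, sub_self, mul_comm (g _), hdiag, neg_zero]
    · rw [← neg_sub z.2 z.1, hodd _ (sub_ne_zero.2 (Ne.symm h)), smul_neg, mul_comm (g _)]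
  have i2 : Integrable (fun z : RSpace d × RSpace d => (g z.2 * f z.1) • k (z.1 - z.2))
      (μ.prod μ) := by
    simp only [e2]
    exact (h1.swap).neg
  have e3 : ∫ z : RSpace d × RSpace d, (g z.2 * f z.1) • k (z.1 - z.2) ∂(μ.prod μ)
      = -∫ z : RSpace d × RSpace d, (f z.2 * g z.1) • k (z.1 - z.2) ∂(μ.prod μ) := by
    simp only [e2]
    rw [integral_neg]
    congr 1
    exact integral_prod_swap (fun z : RSpace d × RSpace d => (f z.2 * g z.1) • k (z.1 - z.2))
  have e4 : lipPairing k μ f g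
      = ∫ z : RSpace d × RSpace d, (f z.2 * g z.1) • k (z.1 - z.2) ∂(μ.prod μ) := by
    have : ∀ z : RSpace d × RSpace d, altProd f g z • k (z.1 - z.2) = (1 / 2 : ℂ) •
        ((f z.2 * g z.1) • k (z.1 - z.2) - (g z.2 * f z.1) • k (z.1 - z.2)) := by
      intro z
      rw [← sub_smul, smul_smul, altProd]
    rw [lipPairing_def]
    simp only [this]
    rw [integral_smul, integral_sub h1 i2, e3, sub_neg_eq_add, ← two_smul ℂ, smul_smul]
    norm_num
  constructor
  · have := h1.integral_prod_left
    simpa only [e1] using this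
  · rw [e4, integral_prod _ h1]
    simp only [e1]

theorem integral_norm_le_of_isLipBump [IsLocallyFiniteMeasure μ] (hμ : IsNiceWith s Λ μ)
    (hΛ : 0 ≤ Λ) (hf : IsLipBump L A R f) (hR : 0 < R) : ∫ y, ‖f y‖ ∂μ ≤ A * (Λ * R ^ s) := by
  have hA := hf.bound_nonneg
  have h1 : ∫ y, ‖f y‖ ∂μ = ∫ y in Metric.ball 0 R, ‖f y‖ ∂μ := by
    rw [setIntegral_eq_integral_of_forall_compl_eq_zero]
    intro x hx
    rw [hf.eq_zero x (by simpa using hx), norm_zero]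
  have hfin : μ (Metric.ball 0 R) < ∞ := (hμ 0 R hR).trans_lt ENNReal.ofReal_lt_top
  have h2 : μ.real (Metric.ball 0 R) ≤ Λ * R ^ s :=
    ENNReal.toReal_le_of_le_ofReal (by positivity) (hμ 0 R hR)
  have h3 := norm_setIntegral_le_of_norm_le_const (μ := μ) (f := fun y => ‖f y‖) (C := A) hfin
    (fun x _ => by simpa using hf.bound x)
  rw [h1]
  refine (Real.le_norm_self _).trans (h3.trans ?_)
  gcongr

/-- The decay at infinity of `T(fμ)` for `f` of mean zero. -/
theorem norm_integral_kernel_le [IsLocallyFiniteMeasure μ] {C : ℝ} (hC : 0 ≤ C)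
    (hK : IsCZKernel s α K)
    (hKC : ∀ u v : RSpace d, v ≠ 0 → ‖u - v‖ ≤ ‖v‖ / 2 →
      ‖K u - K v‖ ≤ C * ‖u - v‖ ^ α / ‖v‖ ^ ((s : ℝ) + α))
    (hμ : IsNiceWith s Λ μ) (hΛ : 0 ≤ Λ) (hf : IsLipBump L A R f) (hR : 0 < R)
    (hf0 : ∫ y, f y ∂μ = 0) {x : RSpace d} (hx : 2 * R ≤ ‖x‖) :
    ‖∫ y, f y • K (x - y) ∂μ‖
      ≤ C * R ^ α * (A * (Λ * R ^ s)) * (‖x‖ ^ ((s : ℝ) + α))⁻¹ := by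
  have hα := hK.alpha_pos
  have hx0 : 0 < ‖x‖ := by linarith
  have hb : ∀ y, ‖f y • (K (x - y) - K x)‖ ≤ ‖f y‖ * (C * R ^ α / ‖x‖ ^ ((s : ℝ) + α)) := by
    intro y
    rw [norm_smul]
    rcases le_or_gt R ‖y‖ with hy | hy
    · rw [hf.eq_zero y hy]; simp
    have h1 : ‖x - y - x‖ = ‖y‖ := by rw [sub_sub_cancel_left, norm_neg]
    have h2 := hKC (x - y) x (norm_pos_iff.1 hx0) (by rw [h1]; linarith)
    rw [h1] at h2
    gcongr
    refine h2.trans ?_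
    gcongr
  have i1 : Integrable (fun y => f y • (K (x - y) - K x)) μ := by
    refine (hf.integrable.norm.mul_const (C * R ^ α / ‖x‖ ^ ((s : ℝ) + α))).mono' ?_
      (Filter.Eventually.of_forall hb)
    have h3 := hf.continuous.measurable
    have h4 := hK.measurable
    exact (h3.smul ((h4.comp (measurable_const.sub measurable_id)).sub
      measurable_const)).aestronglyMeasurable
  have e1 : ∫ y, f y • K (x - y) ∂μ = ∫ y, f y • (K (x - y) - K x) ∂μ := by
    have i2 : Integrable (fun y => f y • K x) μ := hf.integrable.smul_const _
    have : (fun y => f y • K (x - y)) = fun y => f y • (K (x - y) - K x) + f y • K x := by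
      funext y; rw [smul_sub, sub_add_cancel]
    rw [this, integral_add i1 i2, integral_smul_const, hf0, zero_smul, add_zero]
  rw [e1]
  refine (norm_integral_le_integral_norm _).trans ?_
  refine (integral_mono i1.norm (hf.integrable.norm.mul_const _) hb).trans ?_
  rw [integral_mul_const, div_eq_mul_inv]
  calc (∫ y, ‖f y‖ ∂μ) * (C * R ^ α * (‖x‖ ^ ((s : ℝ) + α))⁻¹)
      ≤ (A * (Λ * R ^ s)) * (C * R ^ α * (‖x‖ ^ ((s : ℝ) + α))⁻¹) := by
        gcongr
        exact integral_norm_le_of_isLipBump hμ hΛ hf hR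
    _ = _ := by ring

theorem stronglyMeasurable_integral_kernel [SFinite μ] {k : RSpace d → CSpace d'}
    (hk : Measurable k) (hf : Continuous f) :
    StronglyMeasurable fun x => ∫ y, f y • k (x - y) ∂μ := by
  have hf' := hf.measurable
  have : StronglyMeasurable fun z : RSpace d × RSpace d => f z.2 • k (z.1 - z.2) :=
    ((hf'.comp measurable_snd).smul
      (hk.comp (measurable_fst.sub measurable_snd))).stronglyMeasurable
  exact this.integral_prod_right'

end

/-- For `f` of mean zero, `⟨T(fμ), 1⟩_μ` is computed with an error `O(N^(-α))` by any bounded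
Lipschitz cutoff that is `1` on `B(0,N)`; the error is uniform in the measure. -/
theorem exists_norm_lipPairing_sub_extPairing_le (hs : 0 < s) (hK : IsCZKernel s α K) (hΛ : 0 ≤ Λ)
    {A R : ℝ} (hR : 0 < R) (hA : 0 ≤ A) :
    ∃ C : ℝ, 0 ≤ C ∧ ∀ (μ : Measure (RSpace d)) (_ : IsLocallyFiniteMeasure μ) (L : ℝ)
      (f χ ψ : RSpace d → ℂ) (N : ℝ), IsNiceWith s Λ μ → 0 ≤ L → IsLipBump L A R f →
      ∫ y, f y ∂μ = 0 → 2 * R ≤ N → IsLipZero χ → IsLipZero ψ → (∀ x, ‖χ x‖ ≤ 1) →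
      (∀ x, ‖x‖ < N → χ x = 1) → (∀ x, f x ≠ 0 → ψ x = 1) →
      ‖lipPairing K μ f χ - extPairing K μ ψ f (fun _ => 1)‖ ≤ C * N ^ (-α) := by
  obtain ⟨CK, hCK, hKC⟩ := hK.norm_sub_le hs
  have hα := hK.alpha_pos
  have h2α : (2 : ℝ) ^ (-α) < 1 := Real.rpow_lt_one_of_one_lt_of_neg (by norm_num) (by linarith)
  have h2α' : 0 < 1 - (2 : ℝ) ^ (-α) := by linarith
  set D : ℝ := CK * R ^ α * (A * (Λ * R ^ s)) with hD
  have hD0 : 0 ≤ D := by positivity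
  refine ⟨2 * D * (Λ * 3 ^ s * (1 - 2 ^ (-α))⁻¹), by positivity, ?_⟩
  intro μ _ L f χ ψ N hμ hL hf hf0 hN hχ hψ hχ1 hχN hψf
  have hN0 : 0 < N := by linarith
  set T : RSpace d → CSpace d' := fun x => ∫ y, f y • K (x - y) ∂μ with hT
  have hTm : StronglyMeasurable T :=
    stronglyMeasurable_integral_kernel hK.measurable hf.continuous
  obtain ⟨Lχ, Aχ, Rχ, hLχ, hRχ, bχ⟩ := hχ.exists_isLipBump
  obtain ⟨Lψ, Aψ, Rψ, hLψ, hRψ, bψ⟩ := hψ.exists_isLipBump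
  set R' := max R (max Rχ Rψ)
  have hR' : 0 < R' := lt_max_of_lt_left hR
  have bf := hf.mono_radius (le_max_left R (max Rχ Rψ))
  replace bχ := bχ.mono_radius (show Rχ ≤ R' from (le_max_left _ _).trans (le_max_right _ _))
  replace bψ := bψ.mono_radius (show Rψ ≤ R' from (le_max_right _ _).trans (le_max_right _ _))
  have bg := bχ.add (bψ.const_mul (-1))
  -- `f (χ - ψ) = 0`, so the pairing of `f` with `χ - ψ` is an ordinary integral.
  have hfg : ∀ x, f x * (χ x + -1 * ψ x) = 0 := by
    intro x
    by_cases hfx : f x = 0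
    · rw [hfx, zero_mul]
    · have hxR : ‖x‖ < R := not_le.1 fun h => hfx (hf.eq_zero x h)
      rw [hψf x hfx, hχN x (by linarith)]
      ring
  obtain ⟨i1, e1⟩ := lipPairing_eq_integral_of_integrable hK.odd (fun x => by rw [hfg, zero_smul])
    (integrable_mul_smul_of_mul_eq_zero hs hK hμ hΛ bf bg hL (by positivity) hR' hfg)
  rw [lipPairing_add_right hs hμ hΛ bf bχ (bψ.const_mul (-1)) hL hLχ (by positivity) hR'
    hK.measurable hK.bound, lipPairing_const_mul_right, neg_one_smul, ← sub_eq_add_neg] at e1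
  have tail : ∫⁻ x, ‖(1 - χ x) • T x‖ₑ ∂μ
      ≤ ENNReal.ofReal (2 * D * (Λ * 3 ^ s * (1 - 2 ^ (-α))⁻¹) * N ^ (-α)) := by
    rw [← setLIntegral_eq_of_support_subset (s := {x | N ≤ ‖x‖})]
    · calc ∫⁻ x in {x | N ≤ ‖x‖}, ‖(1 - χ x) • T x‖ₑ ∂μ
          ≤ ∫⁻ x in {x | N ≤ ‖x‖}, ENNReal.ofReal (2 * D) * (‖x‖ₑ ^ ((s : ℝ) + α))⁻¹ ∂μ := by
            refine setLIntegral_mono' (measurableSet_le measurable_const measurable_norm)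
              fun x hx => ?_
            have hx' : N ≤ ‖x‖ := hx
            have hx0 : 0 < ‖x‖ := by linarith
            rw [← ofReal_norm x, ENNReal.ofReal_rpow_of_pos hx0,
              ← ENNReal.ofReal_inv_of_pos (Real.rpow_pos_of_pos hx0 _),
              ← ENNReal.ofReal_mul (by positivity), ← ofReal_norm]
            refine ENNReal.ofReal_le_ofReal ?_
            rw [norm_smul, mul_assoc]
            have h1 : ‖1 - χ x‖ ≤ 2 := by
              refine (norm_sub_le _ _).trans ?_
              rw [norm_one]
              linarith [hχ1 x]
            gcongr
            exact norm_integral_kernel_le hCK hK hKC hμ hΛ hf hR hf0 (hN.trans hx')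
        _ ≤ _ := by
            rw [lintegral_const_mul' _ _ ENNReal.ofReal_ne_top, mul_assoc (2 * D),
              ENNReal.ofReal_mul (p := 2 * D) (by positivity)]
            gcongr
            exact hμ.lintegral_compl_ball_le hΛ hα hN0
    · intro x hx
      by_contra hc
      refine hx ?_
      beta_reduce
      rw [hχN x (not_le.1 hc)]
      simp
  have i2 : Integrable (fun x => (1 - χ x) • T x) μ := by
    refine ⟨?_, tail.trans_lt ENNReal.ofReal_lt_top⟩
    have hχc := bχ.continuous
    exact ((by fun_prop : Continuous fun x => 1 - χ x).aestronglyMeasurable).smul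
      hTm.aestronglyMeasurable
  have e2 : extPairing K μ ψ f (fun _ => 1) = lipPairing K μ f ψ +
      ∫ x, ((1 - χ x) • T x + (χ x + -1 * ψ x) • T x) ∂μ := by
    rw [extPairing]
    simp only [mul_one]
    congr 1
    refine integral_congr_ae (Filter.Eventually.of_forall fun x => ?_)
    simp only [hT]
    rw [← add_smul]
    congr 1; ring
  have e3 : lipPairing K μ f χ - extPairing K μ ψ f (fun _ => 1) = -∫ x, (1 - χ x) • T x ∂μ := by
    rw [e2, integral_add i2 i1, ← e1]
    abel
  rw [e3, norm_neg, ← ENNReal.ofReal_le_ofReal_iff (by positivity), ofReal_norm]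
  exact (enorm_integral_le_lintegral_enorm _).trans tail

end Tail

/-! ### Vague convergence of measures -/

section Vague

open Filter Topology
open scoped CompactlySupported

variable {X : Type*} [MetricSpace X]

/-- The tent function equal to `1` on the ball of radius `a` and vanishing off the ball of
radius `b`. -/
noncomputable def tent (x : X) (a b : ℝ) (y : X) : ℝ := max 0 (min 1 ((b - dist y x) / (b - a)))

section Tent

variable {x : X} {a b : ℝ}

theorem continuous_tent : Continuous (tent x a b) := by
  unfold tent
  fun_prop

theorem tent_nonneg (y : X) : 0 ≤ tent x a b y := le_max_left _ _

theorem tent_le_one (y : X) : tent x a b y ≤ 1 := max_le zero_le_one (min_le_left _ _)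

theorem tent_eq_one (hab : a < b) {y : X} (hy : dist y x ≤ a) : tent x a b y = 1 := by
  have : 1 ≤ (b - dist y x) / (b - a) := by
    rw [one_le_div (by linarith)]; linarith
  rw [tent, min_eq_left this, max_eq_right zero_le_one]

theorem tent_eq_zero (hab : a < b) {y : X} (hy : b ≤ dist y x) : tent x a b y = 0 := by
  have : (b - dist y x) / (b - a) ≤ 0 := div_nonpos_of_nonpos_of_nonneg (by linarith) (by linarith)
  rw [tent, max_eq_left]
  exact (min_le_right _ _).trans this

theorem abs_tent_sub_tent_le (hab : a < b) (y z : X) :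
    |tent x a b y - tent x a b z| ≤ 1 / (b - a) * dist y z := by
  have h1 : |(b - dist y x) / (b - a) - (b - dist z x) / (b - a)| ≤ 1 / (b - a) * dist y z := by
    rw [← sub_div, sub_sub_sub_cancel_left, abs_div, abs_of_pos (by linarith : 0 < b - a),
      div_eq_mul_inv, mul_comm, one_div]
    have : |dist z x - dist y x| ≤ dist y z := by
      rw [dist_comm y z]
      exact abs_dist_sub_le z y x
    have hinv : 0 ≤ (b - a)⁻¹ := inv_nonneg.2 (by linarith)
    gcongr
  refine le_trans ?_ h1
  unfold tent
  refine (abs_max_sub_max_le_max _ _ _ _).trans ?_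
  rw [sub_self, abs_zero, max_eq_right (abs_nonneg _)]
  refine (abs_min_sub_min_le_max _ _ _ _).trans ?_
  rw [sub_self, abs_zero, max_eq_right (abs_nonneg _)]

theorem hasCompactSupport_tent [ProperSpace X] (hab : a < b) : HasCompactSupport (tent x a b) :=
  HasCompactSupport.intro (isCompact_closedBall x b) fun y hy =>
    tent_eq_zero hab (by rw [Metric.mem_closedBall, not_le] at hy; exact hy.le)

end Tent

variable [MeasurableSpace X] {ι : Type*}

/-- Vague convergence of the measures `m i` to `ν` along the filter `l`: convergence of the
integrals of continuous compactly supported real functions. -/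
def VagueTendsto (l : Filter ι) (m : ι → Measure X) (ν : Measure X) : Prop :=
  ∀ f : X → ℝ, Continuous f → HasCompactSupport f →
    Tendsto (fun i => ∫ x, f x ∂(m i)) l (𝓝 (∫ x, f x ∂ν))

theorem norm_integral_le_of_eq_zero_off_ball {E : Type*} [NormedAddCommGroup E] [NormedSpace ℝ E]
    {m : Measure X} {h : X → E} {x₀ : X} {R ε C : ℝ} (hε : ∀ x, ‖h x‖ ≤ ε) (hC : 0 ≤ C)
    (hm : m (Metric.ball x₀ R) ≤ ENNReal.ofReal C) (h0 : ∀ x ∉ Metric.ball x₀ R, h x = 0) :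
    ‖∫ x, h x ∂m‖ ≤ ε * C := by
  have hε0 : 0 ≤ ε := (norm_nonneg _).trans (hε x₀)
  rw [← setIntegral_eq_integral_of_forall_compl_eq_zero h0]
  refine (norm_setIntegral_le_of_norm_le_const (hm.trans_lt ENNReal.ofReal_lt_top)
    fun x _ => hε x).trans ?_
  gcongr
  exact ENNReal.toReal_le_of_le_ofReal hC hm

variable [BorelSpace X]

theorem VagueTendsto.tendsto_integral {l : Filter ι} {m : ι → Measure X} {ν : Measure X}
    [∀ i, IsLocallyFiniteMeasure (m i)] [IsLocallyFiniteMeasure ν]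
    {E : Type*} [NormedAddCommGroup E] [NormedSpace ℝ E] [FiniteDimensional ℝ E]
    (h : VagueTendsto l m ν) {F : X → E} (hF : Continuous F) (hFc : HasCompactSupport F) :
    Tendsto (fun i => ∫ x, F x ∂(m i)) l (𝓝 (∫ x, F x ∂ν)) := by
  let b := Module.finBasis ℝ E
  have key : ∀ (m' : Measure X) [IsLocallyFiniteMeasure m'],
      ∫ x, F x ∂m' = ∑ j, (∫ x, b.coord j (F x) ∂m') • b j := by
    intro m' _
    have hint : Integrable F m' := hF.integrable_of_hasCompactSupport hFc
    have hc : ∀ j, b.coord j (∫ x, F x ∂m') = ∫ x, b.coord j (F x) ∂m' := by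
      intro j
      exact ((LinearMap.toContinuousLinearMap (b.coord j)).integral_comp_comm hint).symm
    conv_lhs => rw [← b.sum_repr (∫ x, F x ∂m')]
    exact Finset.sum_congr rfl fun j _ => by rw [← hc j]; rfl
  simp only [key]
  refine tendsto_finsetSum _ fun j _ => Tendsto.smul_const ?_ _
  refine h _ ((LinearMap.continuous_of_finiteDimensional (b.coord j)).comp hF) ?_
  exact hFc.comp_left (map_zero _)

variable [ProperSpace X]

/-- Vague compactness: along an ultrafilter, locally uniformly bounded measures converge. -/
theorem exists_vagueTendsto (U : Ultrafilter ι) (m : ι → Measure X)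
    [∀ i, IsLocallyFiniteMeasure (m i)] (x₀ : X)
    (hb : ∀ R : ℝ, ∃ C : ℝ, ∀ i, m i (Metric.ball x₀ R) ≤ ENNReal.ofReal C) :
    ∃ ν : Measure X, IsLocallyFiniteMeasure ν ∧ VagueTendsto (U : Filter ι) m ν := by
  have hlim : ∀ f : C_c(X, ℝ), ∃ t : ℝ, Tendsto (fun i => ∫ x, f x ∂(m i)) U (𝓝 t) := by
    intro f
    obtain ⟨A, hA⟩ := f.hasCompactSupport.exists_bound_of_continuous f.continuous
    obtain ⟨R, hR⟩ := f.hasCompactSupport.isCompact.isBounded.subset_ball x₀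
    obtain ⟨C, hC⟩ := hb R
    have hmem : ∀ i, ∫ x, f x ∂(m i) ∈ Metric.closedBall (0 : ℝ) (A * max C 0) := by
      intro i
      rw [mem_closedBall_zero_iff]
      refine norm_integral_le_of_eq_zero_off_ball hA (le_max_right _ _)
        ((hC i).trans (ENNReal.ofReal_le_ofReal (le_max_left _ _))) fun x hx => ?_
      exact image_eq_zero_of_notMem_tsupport fun h => hx (hR h)
    obtain ⟨t, -, ht⟩ := (isCompact_closedBall (0 : ℝ) (A * max C 0)).ultrafilter_le_nhds
      (U.map fun i => ∫ x, f x ∂(m i))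
      (le_principal_iff.2 (Filter.mem_map.2 (Eventually.of_forall hmem)))
    exact ⟨t, ht⟩
  choose Λ hΛ using hlim
  let lin : C_c(X, ℝ) →ₗ[ℝ] ℝ :=
    { toFun := Λ
      map_add' := fun f g => by
        refine tendsto_nhds_unique (hΛ (f + g)) (((hΛ f).add (hΛ g)).congr fun i => ?_)
        exact (integral_add (f.continuous.integrable_of_hasCompactSupport f.hasCompactSupport)
          (g.continuous.integrable_of_hasCompactSupport g.hasCompactSupport)).symm
      map_smul' := fun c f => by
        refine tendsto_nhds_unique (hΛ (c • f)) (((hΛ f).const_smul c).congr fun i => ?_)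
        rw [← integral_smul]
        rfl }
  let pos : C_c(X, ℝ) →ₚ[ℝ] ℝ := PositiveLinearMap.mk₀ lin fun f hf =>
    ge_of_tendsto' (hΛ f) fun i => integral_nonneg fun x => hf x
  refine ⟨RealRMK.rieszMeasure pos, inferInstance, fun f hf hfc => ?_⟩
  have e := RealRMK.integral_rieszMeasure pos ⟨⟨f, hf⟩, hfc⟩
  have e2 : ∫ x, f x ∂(RealRMK.rieszMeasure pos) = Λ ⟨⟨f, hf⟩, hfc⟩ := e
  rw [e2]
  exact hΛ ⟨⟨f, hf⟩, hfc⟩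

namespace VagueTendsto

variable {l : Filter ι} {m : ι → Measure X} {ν : Measure X}
variable [∀ i, IsLocallyFiniteMeasure (m i)] [IsLocallyFiniteMeasure ν]
variable {E : Type*} [NormedAddCommGroup E] [NormedSpace ℝ E] [FiniteDimensional ℝ E]

/-- Vague convergence passes to product measures. -/
theorem tendsto_integral_prod (h : VagueTendsto l m ν) {x₀ : X}
    (hb : ∀ R : ℝ, ∃ C : ℝ, ∀ i, m i (Metric.ball x₀ R) ≤ ENNReal.ofReal C)
    {F : X × X → E} (hF : Continuous F) (hFc : HasCompactSupport F) :
    Tendsto (fun i => ∫ z, F z ∂((m i).prod (m i))) l (𝓝 (∫ z, F z ∂(ν.prod ν))) := by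
  obtain ⟨R, hR⟩ := hFc.isCompact.isBounded.subset_ball (x₀, x₀)
  have hF0 : ∀ x y, (x ∉ Metric.ball x₀ R ∨ y ∉ Metric.ball x₀ R) → F (x, y) = 0 := by
    intro x y hxy
    refine image_eq_zero_of_notMem_tsupport fun hz => ?_
    have := hR hz
    rw [← ball_prod_same] at this
    exact hxy.elim (fun h => h this.1) (fun h => h this.2)
  obtain ⟨C₀, hC₀⟩ := hb R
  set C := max C₀ (ν (Metric.ball x₀ R)).toReal
  have hC0 : 0 ≤ C := ENNReal.toReal_nonneg.trans (le_max_right _ _)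
  have hC : ∀ i, m i (Metric.ball x₀ R) ≤ ENNReal.ofReal C := fun i =>
    (hC₀ i).trans (ENNReal.ofReal_le_ofReal (le_max_left _ _))
  have hCν : ν (Metric.ball x₀ R) ≤ ENNReal.ofReal C := by
    rw [← ENNReal.ofReal_toReal (measure_ball_lt_top (μ := ν) (x := x₀) (r := R)).ne]
    exact ENNReal.ofReal_le_ofReal (le_max_right _ _)
  have hsec : ∀ x, Continuous fun y => F (x, y) := fun x => hF.comp (by fun_prop)
  have hsecc : ∀ x, HasCompactSupport fun y => F (x, y) := fun x =>
    HasCompactSupport.intro (isCompact_closedBall x₀ R) fun y hy =>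
      hF0 x y (Or.inr fun h => hy (Metric.ball_subset_closedBall h))
  have hG0 : ∀ (m' : Measure X), ∀ x ∉ Metric.ball x₀ R, ∫ y, F (x, y) ∂m' = 0 := by
    intro m' x hx
    simp [hF0 x _ (Or.inl hx)]
  have hGc : ∀ (m' : Measure X) [IsLocallyFiniteMeasure m'],
      Continuous fun x => ∫ y, F (x, y) ∂m' := by
    intro m' _
    have h1 := continuous_parametric_integral_of_continuous (μ := m')
      (f := fun x y => F (x, y)) (by simpa [Function.uncurry_def] using hF)
      (isCompact_closedBall x₀ R)
    refine h1.congr fun x => ?_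
    refine setIntegral_eq_integral_of_forall_compl_eq_zero fun y hy => ?_
    exact hF0 x y (Or.inr fun h => hy (Metric.ball_subset_closedBall h))
  have hGs : ∀ (m' : Measure X), HasCompactSupport fun x => ∫ y, F (x, y) ∂m' := fun m' =>
    HasCompactSupport.intro (isCompact_closedBall x₀ R) fun x hx =>
      hG0 m' x fun h => hx (Metric.ball_subset_closedBall h)
  have hFint : ∀ (m' : Measure X) [IsLocallyFiniteMeasure m'],
      ∫ z, F z ∂(m'.prod m') = ∫ x, ∫ y, F (x, y) ∂m' ∂m' := fun m' _ =>
    integral_prod _ (hF.integrable_of_hasCompactSupport hFc)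
  -- The partial integrals `∫ F(x,y) d(m i)(y)` are equicontinuous in `x`, uniformly in `i`, so they
  -- converge uniformly: it is enough to have convergence at the points of a finite net.
  have hunif : ∀ ε > 0, ∀ᶠ i in l, ∀ x, ‖∫ y, F (x, y) ∂(m i) - ∫ y, F (x, y) ∂ν‖ ≤ ε := by
    intro ε hε
    set η := ε / (2 * C + 1) with hη
    have hη0 : 0 < η := by positivity
    obtain ⟨δ, hδ, hunifF⟩ := Metric.uniformContinuous_iff.1
      (hFc.uniformContinuous_of_continuous hF) η hη0
    obtain ⟨t, -, htf, ht⟩ := finite_cover_balls_of_compact (isCompact_closedBall x₀ R) hδ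
    have hev : ∀ᶠ i in l, ∀ x ∈ t, ‖∫ y, F (x, y) ∂(m i) - ∫ y, F (x, y) ∂ν‖ < η := by
      rw [Filter.eventually_all_finite htf]
      intro x _
      have := h.tendsto_integral (hsec x) (hsecc x)
      simpa [dist_eq_norm] using (Metric.tendsto_nhds.1 this) η hη0
    filter_upwards [hev] with i hi x
    by_cases hx : x ∈ Metric.ball x₀ R
    swap
    · rw [hG0 _ x hx, hG0 _ x hx]
      simpa using hε.le
    obtain ⟨x', hx't, hx'⟩ := Set.mem_iUnion₂.1 (ht (Metric.ball_subset_closedBall hx))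
    have hclose : ∀ (m' : Measure X) [IsLocallyFiniteMeasure m'],
        m' (Metric.ball x₀ R) ≤ ENNReal.ofReal C →
        ‖∫ y, F (x, y) ∂m' - ∫ y, F (x', y) ∂m'‖ ≤ η * C := by
      intro m' _ hm'
      rw [← integral_sub ((hsec x).integrable_of_hasCompactSupport (hsecc x))
        ((hsec x').integrable_of_hasCompactSupport (hsecc x'))]
      refine norm_integral_le_of_eq_zero_off_ball (x₀ := x₀) (R := R) (fun y => ?_) hC0 hm'
        fun y hy => ?_
      · rw [← dist_eq_norm]
        refine (hunifF ?_).le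
        rw [Prod.dist_eq]
        simpa [hδ] using hx'
      · rw [hF0 _ _ (Or.inr hy), hF0 _ _ (Or.inr hy), sub_zero]
    have h1 := hclose (m i) (hC i)
    have h2 := hclose ν hCν
    rw [norm_sub_rev] at h2
    have h3 := (hi x' hx't).le
    have e : ∫ y, F (x, y) ∂(m i) - ∫ y, F (x, y) ∂ν
        = (∫ y, F (x, y) ∂(m i) - ∫ y, F (x', y) ∂(m i))
          + (∫ y, F (x', y) ∂(m i) - ∫ y, F (x', y) ∂ν)
          + (∫ y, F (x', y) ∂ν - ∫ y, F (x, y) ∂ν) := by abel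
    rw [e]
    refine norm_add₃_le.trans ?_
    calc _ ≤ η * C + η + η * C := by gcongr
      _ = ε := by rw [hη]; field_simp; ring
  have hlimG := h.tendsto_integral (hGc ν) (hGs ν)
  have hdiff : Tendsto (fun i => ∫ x, (∫ y, F (x, y) ∂(m i)) ∂(m i)
      - ∫ x, (∫ y, F (x, y) ∂ν) ∂(m i)) l (𝓝 0) := by
    rw [Metric.tendsto_nhds]
    intro ε hε
    filter_upwards [hunif (ε / (C + 1)) (by positivity)] with i hi
    rw [dist_zero_right, ← integral_sub ((hGc (m i)).integrable_of_hasCompactSupport (hGs (m i)))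
      ((hGc ν).integrable_of_hasCompactSupport (hGs ν))]
    refine (norm_integral_le_of_eq_zero_off_ball hi hC0 (hC i) fun x hx => ?_).trans_lt ?_
    · rw [hG0 _ x hx, hG0 _ x hx, sub_zero]
    · rw [div_mul_eq_mul_div, div_lt_iff₀ (by positivity)]
      nlinarith
  have := hdiff.add hlimG
  simp only [sub_add_cancel, zero_add] at this
  rw [hFint ν]
  simpa only [hFint (m _)] using this

end VagueTendsto

section Tent

variable {x : X} {a b : ℝ}

variable {m : Measure X} [IsLocallyFiniteMeasure m]

theorem measureReal_ball_le_integral_tent (hab : a < b) :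
    m.real (Metric.ball x a) ≤ ∫ y, tent x a b y ∂m := by
  rw [← integral_indicator_one Metric.isOpen_ball.measurableSet]
  refine integral_mono_of_nonneg (Eventually.of_forall fun y => ?_)
    (continuous_tent.integrable_of_hasCompactSupport (hasCompactSupport_tent hab))
    (Eventually.of_forall fun y => ?_)
  · exact Set.indicator_nonneg (fun _ _ => zero_le_one) y
  · by_cases hy : y ∈ Metric.ball x a
    · simp only [Set.indicator_of_mem hy]
      rw [tent_eq_one hab (Metric.mem_ball.1 hy).le]
      rfl
    · simp only [Set.indicator_of_notMem hy]
      exact tent_nonneg y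

theorem integral_tent_le_measureReal_ball (hab : a < b) :
    ∫ y, tent x a b y ∂m ≤ m.real (Metric.ball x b) := by
  rw [← integral_indicator_one Metric.isOpen_ball.measurableSet]
  refine integral_mono_of_nonneg (Eventually.of_forall tent_nonneg) ?_
    (Eventually.of_forall fun y => ?_)
  · exact (integrable_indicator_iff Metric.isOpen_ball.measurableSet).2
      (integrableOn_const measure_ball_lt_top.ne)
  · by_cases hy : y ∈ Metric.ball x b
    · simp only [Set.indicator_of_mem hy]
      exact tent_le_one y
    · simp only [Set.indicator_of_notMem hy]
      rw [tent_eq_zero hab (by simpa using hy)]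

end Tent

namespace VagueTendsto

variable {l : Filter ι} {m : ι → Measure X} {ν : Measure X}
variable [∀ i, IsLocallyFiniteMeasure (m i)] [IsLocallyFiniteMeasure ν]

theorem measure_ball_le [l.NeBot] (h : VagueTendsto l m ν) {x : X} {b c : ℝ} (hc : 0 ≤ c)
    (hm : ∀ᶠ i in l, m i (Metric.ball x b) ≤ ENNReal.ofReal c) :
    ν (Metric.ball x b) ≤ ENNReal.ofReal c := by
  have key : ∀ a < b, ν (Metric.ball x a) ≤ ENNReal.ofReal c := by
    intro a hab
    have h1 := h _ continuous_tent (hasCompactSupport_tent (x := x) hab)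
    have h2 : ∫ y, tent x a b y ∂ν ≤ c := by
      refine le_of_tendsto h1 ?_
      filter_upwards [hm] with i hi
      exact (integral_tent_le_measureReal_ball hab).trans
        (ENNReal.toReal_le_of_le_ofReal hc hi)
    rw [← ENNReal.ofReal_toReal (measure_ball_lt_top (μ := ν) (x := x) (r := a)).ne]
    exact ENNReal.ofReal_le_ofReal ((measureReal_ball_le_integral_tent hab).trans h2)
  obtain ⟨u, hu, hub, hut⟩ := exists_seq_strictMono_tendsto b
  have hun : Metric.ball x b = ⋃ n, Metric.ball x (u n) := by
    ext y
    simp only [Set.mem_iUnion, Metric.mem_ball]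
    constructor
    · intro hy
      exact ((hut.eventually (lt_mem_nhds hy)).exists)
    · rintro ⟨n, hn⟩
      exact hn.trans (hub n)
  rw [hun, Monotone.measure_iUnion]
  · exact iSup_le fun n => key _ (hub n)
  · intro i j hij
    exact Metric.ball_subset_ball (hu.monotone hij)

theorem le_measure_ball [l.NeBot] (h : VagueTendsto l m ν) {x : X} {a b c : ℝ} (hab : a < b)
    (hm : ∀ᶠ i in l, ENNReal.ofReal c ≤ m i (Metric.ball x a)) :
    ENNReal.ofReal c ≤ ν (Metric.ball x b) := by
  have h1 := h _ continuous_tent (hasCompactSupport_tent (x := x) hab)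
  have h2 : c ≤ ∫ y, tent x a b y ∂ν := by
    refine ge_of_tendsto h1 ?_
    filter_upwards [hm] with i hi
    refine le_trans ?_ (measureReal_ball_le_integral_tent hab)
    exact (ENNReal.ofReal_le_iff_le_toReal measure_ball_lt_top.ne).1 hi
  rw [ENNReal.ofReal_le_iff_le_toReal measure_ball_lt_top.ne]
  exact h2.trans (integral_tent_le_measureReal_ball hab)

theorem eventually_support_inter_ball (h : VagueTendsto l m ν) {x : X} (hx : x ∈ ν.support)
    {ε : ℝ} (hε : 0 < ε) : ∀ᶠ i in l, (Metric.ball x ε ∩ (m i).support).Nonempty := by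
  have hpos : 0 < ν (Metric.ball x (ε / 2)) :=
    (Measure.mem_support_iff_forall x).1 hx _ (Metric.ball_mem_nhds x (by positivity))
  have h1 : 0 < ∫ y, tent x (ε / 2) ε y ∂ν :=
    (ENNReal.toReal_pos hpos.ne' measure_ball_lt_top.ne).trans_le
      (measureReal_ball_le_integral_tent (by linarith))
  have h2 := h _ continuous_tent (hasCompactSupport_tent (x := x) (by linarith : ε / 2 < ε))
  filter_upwards [h2.eventually (lt_mem_nhds h1)] with i hi
  have h3 : 0 < (m i).real (Metric.ball x ε) :=
    hi.trans_le (integral_tent_le_measureReal_ball (by linarith))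
  exact Measure.nonempty_inter_support_of_pos (ENNReal.toReal_pos_iff.1 h3).1

end VagueTendsto

end Vague

/-! ### Limits of Ahlfors–David regular measures -/

section Limits

open Filter Topology

variable {d d' s : ℕ} {α Λ : ℝ} {K : RSpace d → CSpace d'}
variable {ι : Type*} {l : Filter ι} {m : ι → Measure (RSpace d)} {ν : Measure (RSpace d)}

theorem exists_measure_ball_le (hm : ∀ i, IsNiceWith s Λ (m i)) (R : ℝ) :
    ∃ C : ℝ, ∀ i, m i (Metric.ball 0 R) ≤ ENNReal.ofReal C := by
  rcases le_or_gt R 0 with hR | hR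
  · exact ⟨0, fun i => by simp [Metric.ball_eq_empty.2 hR]⟩
  · exact ⟨Λ * R ^ s, fun i => hm i 0 R hR⟩

section

variable [∀ i, IsLocallyFiniteMeasure (m i)] [IsLocallyFiniteMeasure ν]

namespace VagueTendsto

theorem isNiceWith [l.NeBot] (h : VagueTendsto l m ν) (hΛ : 0 ≤ Λ)
    (hm : ∀ i, IsNiceWith s Λ (m i)) : IsNiceWith s Λ ν := fun x r hr =>
  h.measure_ball_le (by positivity) (Eventually.of_forall fun i => hm i x r hr)

theorem isADRegularWith [l.NeBot] (h : VagueTendsto l m ν) (hΛ : 0 ≤ Λ)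
    (hm : ∀ i, IsADRegularWith s Λ (m i)) : IsADRegularWith s Λ ν := by
  refine ⟨h.isNiceWith hΛ fun i => (hm i).1, fun x hx r hr => ?_⟩
  have key : ∀ t ∈ Set.Ioo 0 r, ENNReal.ofReal (1 / Λ * t ^ s) ≤ ν (Metric.ball x r) := by
    intro t ht
    refine h.le_measure_ball (a := (t + r) / 2) (by linarith [ht.2]) ?_
    filter_upwards [h.eventually_support_inter_ball hx (ε := (r - t) / 2) (by linarith [ht.2])]
      with i hi
    obtain ⟨y, hy, hys⟩ := hi
    refine ((hm i).2 y hys t ht.1).trans (measure_mono (Metric.ball_subset_ball' ?_))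
    have := Metric.mem_ball.1 hy
    linarith
  have hlim : Tendsto (fun t : ℝ => ENNReal.ofReal (1 / Λ * t ^ s)) (𝓝[<] r)
      (𝓝 (ENNReal.ofReal (1 / Λ * r ^ s))) :=
    (ENNReal.continuous_ofReal.comp (by fun_prop : Continuous fun t : ℝ =>
      1 / Λ * t ^ s)).continuousAt.tendsto.mono_left nhdsWithin_le_nhds
  refine le_of_tendsto hlim ?_
  filter_upwards [Ioo_mem_nhdsLT hr] with t ht using key t ht

/-- Limits of points of the supports lie in the limiting support, by the lower regularity. -/
theorem mem_support_of_tendsto [l.NeBot] (h : VagueTendsto l m ν) (hΛ : 0 < Λ)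
    (hm : ∀ i, IsADRegularWith s Λ (m i)) {x : ι → RSpace d} {x₀ : RSpace d}
    (hx : Tendsto x l (𝓝 x₀)) (hxs : ∀ i, x i ∈ (m i).support) : x₀ ∈ ν.support := by
  rw [Metric.nhds_basis_ball.mem_measureSupport]
  intro r hr
  refine lt_of_lt_of_le (ENNReal.ofReal_pos.2 (by positivity : 0 < 1 / Λ * (r / 4) ^ s))
    (h.le_measure_ball (a := r / 2) (by linarith) ?_)
  filter_upwards [Metric.tendsto_nhds.1 hx (r / 4) (by positivity)] with i hi
  refine ((hm i).2 (x i) (hxs i) (r / 4) (by positivity)).trans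
    (measure_mono (Metric.ball_subset_ball' ?_))
  linarith

theorem notMem_support_of_tendsto [l.NeBot] (h : VagueTendsto l m ν) {x : ι → RSpace d}
    {x₀ : RSpace d} {δ : ℝ} (hδ : 0 < δ) (hx : Tendsto x l (𝓝 x₀))
    (hxs : ∀ i, Metric.ball (x i) δ ∩ (m i).support = ∅) : x₀ ∉ ν.support := by
  rw [Measure.notMem_support_iff_exists]
  refine ⟨Metric.ball x₀ (δ / 2), Metric.ball_mem_nhds _ (by positivity), ?_⟩
  rw [← nonpos_iff_eq_zero, ← ENNReal.ofReal_zero]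
  refine h.measure_ball_le le_rfl ?_
  filter_upwards [Metric.tendsto_nhds.1 hx (δ / 2) (by positivity)] with i hi
  rw [ENNReal.ofReal_zero, nonpos_iff_eq_zero]
  refine measure_mono_null ?_ (Measure.measure_compl_support (μ := m i))
  intro y hy hys
  have : y ∈ Metric.ball (x i) δ ∩ (m i).support := by
    refine ⟨Metric.ball_subset_ball' ?_ hy, hys⟩
    rw [dist_comm]
    linarith
  rw [hxs i] at this
  exact this

/-- The pairing is continuous under vague convergence: the truncated kernels `K_ε` are continuous,
and they approximate the pairing uniformly in the measure. -/
theorem tendsto_lipPairing [l.NeBot] (h : VagueTendsto l m ν) (hs : 0 < s) (hK : IsCZKernel s α K)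
    (hΛ : 0 ≤ Λ) (hm : ∀ i, IsNiceWith s Λ (m i)) {f φ : RSpace d → ℂ} (hf : IsLipZero f)
    (hφ : IsLipZero φ) :
    Tendsto (fun i => lipPairing K (m i) f φ) l (𝓝 (lipPairing K ν f φ)) := by
  obtain ⟨L, A, R₁, hL, hR₁, bf⟩ := hf.exists_isLipBump
  obtain ⟨L', A', R₂, hL', hR₂, bφ⟩ := hφ.exists_isLipBump
  replace bf := bf.mono_radius (le_max_left R₁ R₂)
  replace bφ := bφ.mono_radius (le_max_right R₁ R₂)
  set R := max R₁ R₂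
  have hR : 0 < R := lt_max_of_lt_left hR₁
  have hA := bf.bound_nonneg
  have hA' := bφ.bound_nonneg
  set M : ℝ := 2 * (A * L' + A' * L) * (Λ * 3 ^ s * (Λ * R ^ s)) with hM
  have hM0 : 0 ≤ M := by positivity
  have happ : ∀ (m' : Measure (RSpace d)) [IsLocallyFiniteMeasure m'], IsNiceWith s Λ m' →
      ∀ ε > 0, ‖lipPairing K m' f φ - lipPairing (regKernel s α K ε) m' f φ‖ ≤ M * ε := by
    intro m' _ hm' ε hε
    refine (norm_lipPairing_sub_regKernel_le hs hK hm' hΛ bf bφ hL hL' hR hε).trans (le_of_eq ?_)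
    rw [hM]; ring
  have hreg : ∀ ε > 0, Tendsto (fun i => lipPairing (regKernel s α K ε) (m i) f φ) l
      (𝓝 (lipPairing (regKernel s α K ε) ν f φ)) := by
    intro ε hε
    simp only [lipPairing_def]
    refine h.tendsto_integral_prod (exists_measure_ball_le hm) ?_ ?_
    · exact (bf.continuous_altProd bφ).smul
        ((hK.continuous_regKernel hε).comp (continuous_fst.sub continuous_snd))
    · refine HasCompactSupport.intro ((isCompact_closedBall (0 : RSpace d) R).prod
        (isCompact_closedBall (0 : RSpace d) R)) fun z hz => ?_
      have : R ≤ ‖z.1‖ ∨ R ≤ ‖z.2‖ := by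
        by_contra! hc
        exact hz ⟨by simpa using hc.1.le, by simpa using hc.2.le⟩
      rw [bf.altProd_eq_zero bφ this, zero_smul]
  rw [Metric.tendsto_nhds]
  intro ε hε
  set η := ε / (3 * (M + 1)) with hη
  have hη0 : 0 < η := by positivity
  have hMη : M * η < ε / 3 := by
    rw [hη, ← mul_div_assoc, div_lt_div_iff₀ (by positivity) (by norm_num)]
    nlinarith
  filter_upwards [Metric.tendsto_nhds.1 (hreg η hη0) (ε / 3) (by positivity)] with i hi
  have h1 := happ (m i) (hm i) η hη0
  have h2 := happ ν (h.isNiceWith hΛ hm) η hη0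
  rw [← dist_eq_norm] at h1 h2
  rw [dist_comm] at h2
  have := dist_triangle4 (lipPairing K (m i) f φ) (lipPairing (regKernel s α K η) (m i) f φ)
    (lipPairing (regKernel s α K η) ν f φ) (lipPairing K ν f φ)
  linarith

end VagueTendsto

end

/-- The support of a measure `c H^s|L` is convex under midpoints: translations along `L` preserve
the measure. -/
theorem IsPlaneMeasure.midpoint_mem_support {ν : Measure (RSpace d)} (hν : IsPlaneMeasure s ν)
    {x y : RSpace d} (hx : x ∈ ν.support) (hy : y ∈ ν.support) :
    (1 / 2 : ℝ) • (x + y) ∈ ν.support := by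
  obtain ⟨c, L, hc, -, -, rfl⟩ := hν
  set H : Measure (RSpace d) := Measure.hausdorffMeasure (s : ℝ) with hH
  have hLc : IsClosed (L : Set (RSpace d)) := L.closed_of_finiteDimensional
  have hsub : (c • H.restrict (L : Set (RSpace d))).support ⊆ L := by
    refine Measure.support_subset_of_isClosed hLc ?_
    rw [mem_ae_iff, Measure.smul_apply, Measure.restrict_apply hLc.measurableSet.compl]
    simp
  have hxL : x ∈ L := hsub hx
  have hyL : y ∈ L := hsub hy
  set v : RSpace d := (1 / 2 : ℝ) • (x + y) - x with hv
  have hvL : v ∈ L.direction := by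
    have h1 := L.direction.smul_mem (1 / 2 : ℝ) (AffineSubspace.vsub_mem_direction hyL hxL)
    have h2 : v = (1 / 2 : ℝ) • (y -ᵥ x) := by
      rw [hv, vsub_eq_sub]; module
    rw [h2]; exact h1
  rw [Metric.nhds_basis_ball.mem_measureSupport] at hx ⊢
  intro r hr
  have h1 := hx r hr
  have hball : ∀ p : RSpace d, (c • H.restrict (L : Set (RSpace d))) (Metric.ball p r)
      = c • H (Metric.ball p r ∩ L) := by
    intro p
    rw [Measure.smul_apply, Measure.restrict_apply Metric.isOpen_ball.measurableSet]
  rw [hball] at h1 ⊢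
  have himg : (IsometryEquiv.addRight v) '' (Metric.ball x r ∩ L)
      ⊆ Metric.ball ((1 / 2 : ℝ) • (x + y)) r ∩ L := by
    rintro _ ⟨z, ⟨hz, hzL⟩, rfl⟩
    refine ⟨?_, ?_⟩
    · have e : (1 / 2 : ℝ) • (x + y) = x + v := by rw [hv]; abel
      rw [e, Metric.mem_ball]
      simpa using hz
    · have := AffineSubspace.vadd_mem_of_mem_direction hvL hzL
      rw [vadd_eq_add, add_comm] at this
      exact this
  have h2 := measure_mono (μ := H) himg
  rw [IsometryEquiv.hausdorffMeasure_image] at h2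
  refine h1.trans_le ?_
  simp only [ENNReal.smul_def, smul_eq_mul]
  gcongr

end Limits

/-! ### Non-flat regular measures are not reflectionless, uniformly -/

section Compactness

open Filter Topology

variable {d d' s : ℕ} {α Λ : ℝ} {K : RSpace d → CSpace d'}

theorem isLipBump_tent (x : RSpace d) {a b : ℝ} (hab : a < b) :
    IsLipBump (1 / (b - a)) 1 (‖x‖ + b) (fun y => (tent x a b y : ℂ)) where
  lip y z := by
    rw [← Complex.ofReal_sub, Complex.norm_real, Real.norm_eq_abs, ← dist_eq_norm]
    exact abs_tent_sub_tent_le hab y z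
  bound y := by
    rw [Complex.norm_real, Real.norm_of_nonneg (tent_nonneg y)]
    exact tent_le_one y
  eq_zero y hy := by
    have : b ≤ dist y x := by
      rw [dist_eq_norm]
      have := norm_le_norm_add_norm_sub x y
      rw [norm_sub_rev] at this
      linarith
    rw [tent_eq_zero hab this, Complex.ofReal_zero]

/-- Let `ν` be the vague limit of regular measures `m n` such that the pairings of every fixed
family of mean-zero bumps, with cutoffs equal to `1` on larger and larger balls, tend to zero.
Then `ν` is reflectionless. -/
theorem isReflectionless_of_vagueTendsto (hs : 0 < s) (hK : IsCZKernel s α K) (hΛ : 0 < Λ)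
    {l : Filter ℕ} [l.NeBot] (hl : l ≤ atTop) {m : ℕ → Measure (RSpace d)}
    {ν : Measure (RSpace d)} [∀ n, IsLocallyFiniteMeasure (m n)] [IsLocallyFiniteMeasure ν]
    (h : VagueTendsto l m ν) (hm : ∀ n, IsNiceWith s Λ (m n)) {x₀ : RSpace d}
    (hx₀ : x₀ ∈ ν.support)
    (hbad : ∀ (n : ℕ) (f : RSpace d → ℂ), IsLipBump 1 1 (n + 1) f → ∫ x, f x ∂(m n) = 0 →
      ∃ χ : RSpace d → ℂ, IsLipZero χ ∧ (∀ x, ‖χ x‖ ≤ 1) ∧ (∀ x, ‖x‖ < n + 1 → χ x = 1) ∧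
        ‖lipPairing K (m n) f χ‖ < 1 / (n + 1)) :
    IsReflectionless s α K ν := by
  have hν := h.isNiceWith hΛ.le hm
  have hα := hK.alpha_pos
  refine ⟨hν.isDiffuse hs hΛ.le, hν.hasRestrictedGrowth hΛ.le hα, ?_⟩
  rintro f hf hf0 ψ hψ ⟨U, -, hfU, hU⟩
  have hψf : ∀ x, f x ≠ 0 → ψ x = 1 := fun x hx => hU x (hfU (subset_tsupport f hx))
  obtain ⟨L, A, R₀, hL, hR₀, bf⟩ := hf.exists_isLipBump
  have hA := bf.bound_nonneg
  set η : RSpace d → ℂ := fun y => (tent x₀ 1 2 y : ℂ) with hη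
  have bη : IsLipBump 1 1 (‖x₀‖ + 2) η := by
    have := isLipBump_tent x₀ (a := 1) (b := 2) (by norm_num)
    norm_num at this
    exact this
  set R := max R₀ (‖x₀‖ + 2)
  have hR : 0 < R := lt_max_of_lt_left hR₀
  replace bf := bf.mono_radius (le_max_left R₀ (‖x₀‖ + 2))
  replace bη := bη.mono_radius (le_max_right R₀ (‖x₀‖ + 2))
  have hην : ∫ y, η y ∂ν ≠ 0 := by
    rw [hη, integral_complex_ofReal]
    have hpos : 0 < ν (Metric.ball x₀ 1) :=
      (Measure.mem_support_iff_forall x₀).1 hx₀ _ (Metric.ball_mem_nhds x₀ one_pos)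
    have h1 : 0 < ∫ y, tent x₀ 1 2 y ∂ν :=
      (ENNReal.toReal_pos hpos.ne' measure_ball_lt_top.ne).trans_le
        (measureReal_ball_le_integral_tent (by norm_num))
    exact_mod_cast h1.ne'
  -- The corrected bump `f + c n * η` has mean zero for `m n`, and `c n → 0`.
  set c : ℕ → ℂ := fun n => -((∫ y, f y ∂(m n)) / ∫ y, η y ∂(m n)) with hc
  have hηlim := h.tendsto_integral bη.continuous bη.hasCompactSupport
  have hflim := h.tendsto_integral bf.continuous bf.hasCompactSupport
  have hclim : Tendsto c l (𝓝 0) := by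
    have := (hflim.div hηlim hην).neg
    simpa [hf0] using this
  have hc1 : ∀ᶠ n in l, ‖c n‖ ≤ 1 := by
    filter_upwards [Metric.tendsto_nhds.1 hclim 1 one_pos] with n hn
    rw [dist_zero_right] at hn
    exact hn.le
  have hη0 : ∀ᶠ n in l, ∫ y, η y ∂(m n) ≠ 0 := hηlim.eventually_ne hην
  obtain ⟨C, hC, hCb⟩ := exists_norm_lipPairing_sub_extPairing_le hs hK hΛ.le hR
    (by positivity : 0 ≤ A + 1)
  -- Multiplied by `t`, the corrected bumps have Lipschitz constant and bound at most `1`.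
  set t : ℝ := 1 / (L + A + 1) with ht
  have ht0 : 0 < t := by positivity
  have bfc : ∀ n, ‖c n‖ ≤ 1 → IsLipBump (L + 1) (A + 1) R (fun x => f x + c n * η x) := by
    intro n hn
    exact (bf.add (bη.const_mul (c n))).mono (by linarith) (by linarith)
  have key : ∀ N : ℝ, 2 * R ≤ N → ‖extPairing K ν ψ f (fun _ => 1)‖ ≤ 3 * C * N ^ (-α) := by
    intro N hN
    have hN0 : 0 < N := by linarith
    set χN : RSpace d → ℂ := fun y => (tent 0 N (N + 1) y : ℂ) with hχN
    have bχ : IsLipBump 1 1 (N + 1) χN := by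
      have := isLipBump_tent (0 : RSpace d) (a := N) (b := N + 1) (by linarith)
      simpa using this
    have hχ1 : ∀ x, ‖x‖ < N → χN x = 1 := by
      intro x hx
      rw [hχN]
      simp only
      rw [tent_eq_one (by linarith) (by rw [dist_zero_right]; exact hx.le), Complex.ofReal_one]
    have e1 := hCb ν inferInstance L f χN ψ N hν hL (bf.mono le_rfl (by linarith)) hf0 hN
      bχ.isLipZero hψ bχ.bound hχ1 hψf
    have e2 : ‖lipPairing K ν f χN‖ ≤ 2 * C * N ^ (-α) := by
      have hlim1 : Tendsto (fun n => lipPairing K (m n) f χN + c n • lipPairing K (m n) η χN) l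
          (𝓝 (lipPairing K ν f χN)) := by
        have h1 := h.tendsto_lipPairing hs hK hΛ.le hm bf.isLipZero bχ.isLipZero
        have h2 := h.tendsto_lipPairing hs hK hΛ.le hm bη.isLipZero bχ.isLipZero
        simpa using h1.add (hclim.smul h2)
      have hlim2 : Tendsto (fun n : ℕ => 1 / (t * ((n : ℝ) + 1)) + 2 * C * N ^ (-α)) l
          (𝓝 (0 + 2 * C * N ^ (-α))) := by
        refine Tendsto.add_const _ (Tendsto.mono_left ?_ hl)
        have := (tendsto_one_div_add_atTop_nhds_zero_nat (𝕜 := ℝ)).const_mul (1 / t)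
        rw [mul_zero] at this
        refine this.congr fun n => ?_
        rw [one_div_mul_one_div]
      rw [zero_add] at hlim2
      refine le_of_tendsto_of_tendsto hlim1.norm hlim2 ?_
      have hlarge : ∀ᶠ n : ℕ in l, N ≤ n := hl (eventually_ge_atTop ⌈N⌉₊ |>.mono fun n hn =>
        Nat.ceil_le.1 hn)
      filter_upwards [hc1, hη0, hlarge] with n hn1 hn2 hn3
      have bg := bfc n hn1
      set g : RSpace d → ℂ := fun x => f x + c n * η x with hg
      have hg0 : ∫ x, g x ∂(m n) = 0 := by
        rw [hg, integral_add bf.integrable (bη.integrable.const_mul _), integral_const_mul, hc]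
        field_simp
        simp
      have btg : IsLipBump 1 1 (n + 1) (fun x => (t : ℂ) * g x) := by
        have h1 := (bg.const_mul (t : ℂ)).mono_radius (R' := n + 1) (by linarith)
        rw [Complex.norm_real, Real.norm_of_nonneg ht0.le] at h1
        refine h1.mono ?_ ?_
        · rw [ht, one_div_mul_eq_div, div_le_one (by positivity)]; linarith
        · rw [ht, one_div_mul_eq_div, div_le_one (by positivity)]; linarith
      obtain ⟨χ, hχ, hχb, hχn, hχlt⟩ := hbad n _ btg (by
        rw [integral_const_mul, hg0, mul_zero])
      rw [lipPairing_const_mul_left, norm_smul, Complex.norm_real, Real.norm_of_nonneg ht0.le]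
        at hχlt
      have f1 : ‖lipPairing K (m n) g χ‖ ≤ 1 / (t * ((n : ℝ) + 1)) := by
        rw [← one_div_mul_one_div, one_div_mul_eq_div, le_div_iff₀ ht0, mul_comm]
        exact hχlt.le
      have hgN : ∀ x, g x ≠ 0 → χN x = 1 := by
        intro x hx
        refine hχ1 x ?_
        have : ‖x‖ < R := not_le.1 fun hle => hx (bg.eq_zero x hle)
        linarith
      -- Both `χ` and `χN` compute `⟨T(gμ), 1⟩` up to `C N ^ (-α)`; use `χN` as the reference cutoff.
      have f2 := hCb (m n) inferInstance (L + 1) g χN χN N (hm n) (by linarith) bg hg0 hN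
        bχ.isLipZero bχ.isLipZero bχ.bound hχ1 hgN
      have f3 := hCb (m n) inferInstance (L + 1) g χ χN N (hm n) (by linarith) bg hg0 hN
        hχ bχ.isLipZero hχb (fun x hx => hχn x (by linarith)) hgN
      have f4 : lipPairing K (m n) g χN
          = lipPairing K (m n) f χN + c n • lipPairing K (m n) η χN :=
        lipPairing_add_const_mul_left hs hK (hm n) hΛ.le (bf.mono_radius (by linarith : R ≤ N + 1))
          (bη.mono_radius (by linarith : R ≤ N + 1)) bχ hL zero_le_one zero_le_one (by linarith) _
      rw [← f4]
      set E := extPairing K (m n) χN g fun _ => 1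
      have f5 : lipPairing K (m n) g χN = (lipPairing K (m n) g χN - E)
          - (lipPairing K (m n) g χ - E) + lipPairing K (m n) g χ := by abel
      rw [f5]
      refine (norm_add_le _ _).trans ?_
      have := norm_sub_le (lipPairing K (m n) g χN - E) (lipPairing K (m n) g χ - E)
      linarith
    have e3 : extPairing K ν ψ f (fun _ => 1) = lipPairing K ν f χN
        - (lipPairing K ν f χN - extPairing K ν ψ f (fun _ => 1)) := by abel
    rw [e3]
    refine (norm_sub_le _ _).trans ?_
    linarith
  have hlim : Tendsto (fun N : ℝ => 3 * C * N ^ (-α)) atTop (𝓝 0) := by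
    simpa using (tendsto_rpow_neg_atTop hα).const_mul (3 * C)
  refine norm_le_zero_iff.1 (ge_of_tendsto hlim ?_)
  filter_upwards [eventually_ge_atTop (2 * R)] with N hN using key N hN

/-- A uniform lower bound for the action of `T` on regular measures whose support is far from
being convex. -/
theorem exists_large_lipPairing (hs : 0 < s) (hK : IsCZKernel s α K) (hrigid : IsADRigid s α K)
    (hΛ : 0 < Λ) {δ : ℝ} (hδ : 0 < δ) (R₀ : ℝ) :
    ∃ A Δ : ℝ, 0 < A ∧ 0 < Δ ∧ ∀ m : Measure (RSpace d), IsLocallyFiniteMeasure m →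
      IsADRegularWith s Λ m → ∀ x ∈ m.support, ∀ y ∈ m.support, ‖x‖ ≤ R₀ → ‖y‖ ≤ R₀ →
      Metric.ball ((1 / 2 : ℝ) • (x + y)) δ ∩ m.support = ∅ →
      ∃ f : RSpace d → ℂ, IsLipBump 1 1 A f ∧ ∫ x, f x ∂m = 0 ∧
        ∀ χ : RSpace d → ℂ, IsLipZero χ → (∀ x, ‖χ x‖ ≤ 1) → (∀ x, ‖x‖ < A → χ x = 1) →
          Δ ≤ ‖lipPairing K m f χ‖ := by
  by_contra! hcon
  have hcon' := fun n : ℕ => hcon ((n : ℝ) + 1) (1 / ((n : ℝ) + 1)) (by positivity) (by positivity)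
  choose m hlf hm x hx y hy hxR hyR hempty hbad using hcon'
  set U : Ultrafilter ℕ := Filter.hyperfilter ℕ
  have hUl : (U : Filter ℕ) ≤ atTop := Nat.hyperfilter_le_atTop
  obtain ⟨ν, hνlf, hν⟩ := exists_vagueTendsto U m 0 (exists_measure_ball_le fun n => (hm n).1)
  have hcpt : ∀ z : ℕ → RSpace d, (∀ n, ‖z n‖ ≤ R₀) → ∃ z₀, Tendsto z U (𝓝 z₀) := by
    intro z hz
    obtain ⟨t, -, ht⟩ := (isCompact_closedBall (0 : RSpace d) R₀).ultrafilter_le_nhds (U.map z)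
      (le_principal_iff.2 (Filter.mem_map.2 (Eventually.of_forall fun n => by simpa using hz n)))
    exact ⟨t, ht⟩
  obtain ⟨x₀, hx₀⟩ := hcpt x hxR
  obtain ⟨y₀, hy₀⟩ := hcpt y hyR
  have hx₀s := hν.mem_support_of_tendsto hΛ hm hx₀ hx
  have hy₀s := hν.mem_support_of_tendsto hΛ hm hy₀ hy
  have hmid := hν.notMem_support_of_tendsto hδ ((hx₀.add hy₀).const_smul (1 / 2 : ℝ)) hempty
  have hν0 : ν ≠ 0 := by
    rintro rfl
    simp at hx₀s
  have hrefl := isReflectionless_of_vagueTendsto hs hK hΛ hUl hν (fun n => (hm n).1) hx₀s hbad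
  exact hmid ((hrigid ν hνlf hν0 ⟨Λ, hΛ, hν.isADRegularWith hΛ.le hm⟩ hrefl).midpoint_mem_support
    hx₀s hy₀s)

end Compactness

/-! ### Rescaling -/

section Rescaling

open Filter Topology

variable {d d' s : ℕ} {α Λ : ℝ} {K : RSpace d → CSpace d'} {μ : Measure (RSpace d)}

/-- The homeomorphism `x ↦ (x - c) / t` that maps `B(c,t)` to the unit ball. -/
noncomputable def rescaleMap (c : RSpace d) {t : ℝ} (ht : 0 < t) : RSpace d ≃ₜ RSpace d where
  toFun x := t⁻¹ • (x - c)
  invFun u := c + t • u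
  left_inv x := by beta_reduce; rw [smul_inv_smul₀ ht.ne', add_sub_cancel]
  right_inv u := by beta_reduce; rw [add_sub_cancel_left, inv_smul_smul₀ ht.ne']

theorem rescaleMap_apply (c : RSpace d) {t : ℝ} (ht : 0 < t) (x : RSpace d) :
    rescaleMap c ht x = t⁻¹ • (x - c) := rfl

theorem rescaleMap_symm_apply (c : RSpace d) {t : ℝ} (ht : 0 < t) (u : RSpace d) :
    (rescaleMap c ht).symm u = c + t • u := rfl

theorem dist_rescaleMap (c : RSpace d) {t : ℝ} (ht : 0 < t) (x y : RSpace d) :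
    dist (rescaleMap c ht x) (rescaleMap c ht y) = t⁻¹ * dist x y := by
  rw [rescaleMap_apply, rescaleMap_apply, dist_smul₀, dist_sub_right, Real.norm_of_nonneg
    (inv_nonneg.2 ht.le)]

theorem rescaleMap_preimage_ball (c : RSpace d) {t : ℝ} (ht : 0 < t) (x : RSpace d) (r : ℝ) :
    rescaleMap c ht ⁻¹' Metric.ball (rescaleMap c ht x) r = Metric.ball x (t * r) := by
  ext y
  rw [Set.mem_preimage, Metric.mem_ball, Metric.mem_ball, dist_rescaleMap, inv_mul_lt_iff₀ ht]

/-- The measure `t^(-s) μ(c + t ·)`. -/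
noncomputable def rescale (s : ℕ) (μ : Measure (RSpace d)) (c : RSpace d) {t : ℝ} (ht : 0 < t) :
    Measure (RSpace d) :=
  (ENNReal.ofReal (t ^ s)⁻¹) • μ.map (rescaleMap c ht)

variable (c : RSpace d) {t : ℝ} (ht : 0 < t)

theorem rescale_apply (U : Set (RSpace d)) :
    rescale s μ c ht U = ENNReal.ofReal (t ^ s)⁻¹ * μ (rescaleMap c ht ⁻¹' U) := by
  rw [rescale, Measure.smul_apply, smul_eq_mul]
  congr 1
  exact (rescaleMap c ht).toMeasurableEquiv.map_apply U

theorem rescale_ball (x : RSpace d) (r : ℝ) :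
    rescale s μ c ht (Metric.ball (rescaleMap c ht x) r)
      = ENNReal.ofReal (t ^ s)⁻¹ * μ (Metric.ball x (t * r)) := by
  rw [rescale_apply, rescaleMap_preimage_ball]

theorem rescaleMap_mem_support_rescale {x : RSpace d} :
    rescaleMap c ht x ∈ (rescale s μ c ht).support ↔ x ∈ μ.support := by
  have h0 : ENNReal.ofReal (t ^ s)⁻¹ ≠ 0 := (ENNReal.ofReal_pos.2 (by positivity)).ne'
  rw [Metric.nhds_basis_ball.mem_measureSupport, Metric.nhds_basis_ball.mem_measureSupport]
  constructor
  · intro h r hr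
    have := h (t⁻¹ * r) (by positivity)
    rw [rescale_ball, mul_inv_cancel_left₀ ht.ne'] at this
    exact (CanonicallyOrderedAdd.mul_pos.1 this).2
  · intro h r hr
    rw [rescale_ball]
    exact ENNReal.mul_pos h0 (h (t * r) (by positivity)).ne'

theorem IsADRegularWith.rescale (hμ : IsADRegularWith s Λ μ) :
    IsADRegularWith s Λ (rescale s μ c ht) := by
  have e : ∀ (C r : ℝ), ENNReal.ofReal (t ^ s)⁻¹ * ENNReal.ofReal (C * (t * r) ^ s)
      = ENNReal.ofReal (C * r ^ s) := by
    intro C r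
    rw [← ENNReal.ofReal_mul (by positivity), mul_pow]
    congr 1
    field_simp
  constructor
  · intro x r hr
    obtain ⟨y, rfl⟩ := (rescaleMap c ht).surjective x
    rw [rescale_ball, ← e]
    gcongr
    exact hμ.1 y _ (by positivity)
  · intro x hx r hr
    obtain ⟨y, rfl⟩ := (rescaleMap c ht).surjective x
    rw [rescaleMap_mem_support_rescale] at hx
    rw [rescale_ball, ← e]
    gcongr
    exact hμ.2 y hx _ (by positivity)

theorem isLocallyFiniteMeasure_rescale (hμ : IsNiceWith s Λ μ) :
    IsLocallyFiniteMeasure (rescale s μ c ht) := by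
  refine ⟨fun x => ?_⟩
  obtain ⟨y, rfl⟩ := (rescaleMap c ht).surjective x
  refine ⟨_, Metric.ball_mem_nhds _ one_pos, ?_⟩
  rw [rescale_ball]
  exact ENNReal.mul_lt_top ENNReal.ofReal_lt_top
    ((hμ y _ (by positivity)).trans_lt ENNReal.ofReal_lt_top)

theorem integral_rescale {E : Type*} [NormedAddCommGroup E] [NormedSpace ℝ E] (f : RSpace d → E) :
    ∫ u, f u ∂(rescale s μ c ht) = (t ^ s)⁻¹ • ∫ x, f (rescaleMap c ht x) ∂μ := by
  rw [rescale, integral_smul_measure, ENNReal.toReal_ofReal (by positivity)]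
  congr 1
  exact integral_map_equiv (rescaleMap c ht).toMeasurableEquiv f

theorem lipPairing_rescale [SFinite μ] (hK : IsCZKernel s α K) (f φ : RSpace d → ℂ) :
    lipPairing K (rescale s μ c ht) f φ
      = (t ^ s)⁻¹ • lipPairing K μ (fun x => f (rescaleMap c ht x))
          (fun x => φ (rescaleMap c ht x)) := by
  set e := rescaleMap c ht
  have h1 : (rescale s μ c ht).prod (rescale s μ c ht)
      = ENNReal.ofReal ((t ^ s)⁻¹ * (t ^ s)⁻¹) •
        (μ.prod μ).map (e.toMeasurableEquiv.prodCongr e.toMeasurableEquiv) := by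
    rw [rescale, Measure.prod_smul_left, Measure.prod_smul_right, smul_smul,
      ← ENNReal.ofReal_mul (by positivity),
      Measure.map_prod_map _ _ e.measurable e.measurable]
    rfl
  rw [lipPairing_def, lipPairing_def, h1, integral_smul_measure,
    ENNReal.toReal_ofReal (by positivity), integral_map_equiv, mul_smul]
  congr 1
  rw [← integral_smul]
  refine integral_congr_ae (Eventually.of_forall fun z => ?_)
  have e1 : (e.toMeasurableEquiv.prodCongr e.toMeasurableEquiv) z = (e z.1, e z.2) := rfl
  simp only [e1, altProd]
  by_cases hz : z.1 = z.2
  · rw [hz]; simp [mul_comm]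
  · have e2 : e z.1 - e z.2 = t⁻¹ • (z.1 - z.2) := by
      rw [rescaleMap_apply, rescaleMap_apply, ← smul_sub, sub_sub_sub_cancel_right]
    rw [e2, hK.homogeneous _ _ (inv_pos.2 ht) (sub_ne_zero.2 hz), smul_comm, smul_smul, inv_pow,
      inv_inv, inv_mul_cancel₀ (pow_pos ht s).ne', one_smul]

/-- The scale-invariant form of `exists_large_lipPairing`. -/
theorem exists_large_lipPairing_of_scale (hs : 0 < s) (hK : IsCZKernel s α K)
    (hrigid : IsADRigid s α K) (hΛ : 0 < Λ) {δ : ℝ} (hδ : 0 < δ) (R₀ : ℝ)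
    (μ : Measure (RSpace d)) [IsLocallyFiniteMeasure μ] (hμ : IsADRegularWith s Λ μ) :
    ∃ A Δ : ℝ, 0 < A ∧ 0 < Δ ∧ ∀ (c : RSpace d) (t : ℝ), 0 < t → ∀ x ∈ μ.support, ∀ y ∈ μ.support,
      ‖x - c‖ ≤ R₀ * t → ‖y - c‖ ≤ R₀ * t →
      Metric.ball ((1 / 2 : ℝ) • (x + y)) (δ * t) ∩ μ.support = ∅ →
      ∃ f : RSpace d → ℂ, (∀ x y, ‖f x - f y‖ ≤ t⁻¹ * ‖x - y‖) ∧ (∀ x, ‖f x‖ ≤ 1) ∧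
        (∀ x, A * t ≤ ‖x - c‖ → f x = 0) ∧ ∫ x, f x ∂μ = 0 ∧
        ∀ χ : RSpace d → ℂ, IsLipZero χ → (∀ x, ‖χ x‖ ≤ 1) → (∀ x, ‖x - c‖ < A * t → χ x = 1) →
          Δ * t ^ s ≤ ‖lipPairing K μ f χ‖ := by
  obtain ⟨A, Δ, hA, hΔ, h⟩ := exists_large_lipPairing hs hK hrigid hΛ hδ R₀
  refine ⟨A, Δ, hA, hΔ, fun c t ht x hx y hy hxR hyR hempty => ?_⟩
  set e := rescaleMap c ht with he
  have hnorm : ∀ z, ‖e z‖ = ‖z - c‖ / t := by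
    intro z
    rw [he, rescaleMap_apply, norm_smul, norm_inv, Real.norm_of_nonneg ht.le, div_eq_inv_mul]
  have hmid : (1 / 2 : ℝ) • (e x + e y) = e ((1 / 2 : ℝ) • (x + y)) := by
    simp only [he, rescaleMap_apply]
    module
  obtain ⟨f, bf, hf0, hf⟩ := h (rescale s μ c ht) (isLocallyFiniteMeasure_rescale c ht hμ.1)
    (hμ.rescale c ht) (e x) ((rescaleMap_mem_support_rescale c ht).2 hx) (e y)
    ((rescaleMap_mem_support_rescale c ht).2 hy)
    (by rw [hnorm, div_le_iff₀ ht]; exact hxR) (by rw [hnorm, div_le_iff₀ ht]; exact hyR) (by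
      rw [Set.eq_empty_iff_forall_notMem]
      rintro u ⟨hu, hus⟩
      obtain ⟨z, rfl⟩ := e.surjective u
      rw [rescaleMap_mem_support_rescale] at hus
      rw [hmid, ← Set.mem_preimage, rescaleMap_preimage_ball, mul_comm] at hu
      have : z ∈ Metric.ball ((1 / 2 : ℝ) • (x + y)) (δ * t) ∩ μ.support := ⟨hu, hus⟩
      rw [hempty] at this
      exact this)
  refine ⟨fun x => f (e x), fun x y => ?_, fun x => bf.bound _, fun x hx => ?_, ?_, ?_⟩
  · refine (bf.lip _ _).trans (le_of_eq ?_)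
    rw [← dist_eq_norm, dist_rescaleMap, one_mul, dist_eq_norm]
  · refine bf.eq_zero _ ?_
    rw [hnorm, le_div_iff₀ ht]
    exact hx
  · rw [integral_rescale] at hf0
    exact (smul_eq_zero.1 hf0).resolve_left (by positivity)
  · intro χ hχ hχb hχ1
    have h1 := hf (fun u => χ (e.symm u)) ⟨?_, ?_⟩ (fun u => hχb _) (fun u hu => ?_)
    · rw [lipPairing_rescale c ht hK, norm_smul, Real.norm_of_nonneg (by positivity)] at h1
      have h2 : (fun x => χ (e.symm (rescaleMap c ht x))) = χ := by
        funext x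
        exact congrArg χ (e.symm_apply_apply x)
      rw [h2, inv_mul_eq_div, le_div_iff₀ (by positivity)] at h1
      exact h1
    · obtain ⟨⟨L, hL⟩, -⟩ := hχ
      refine ⟨L * t.toNNReal, LipschitzWith.of_dist_le_mul fun u v => ?_⟩
      refine (hL.dist_le_mul _ _).trans (le_of_eq ?_)
      rw [he, rescaleMap_symm_apply, rescaleMap_symm_apply, dist_add_left, dist_smul₀,
        Real.norm_of_nonneg ht.le, NNReal.coe_mul, Real.coe_toNNReal _ ht.le, mul_assoc]
    · exact hχ.2.comp_homeomorph e.symm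
    · refine hχ1 _ ?_
      rw [he, rescaleMap_symm_apply, add_sub_cancel_left, norm_smul, Real.norm_of_nonneg ht.le,
        mul_comm]
      gcongr

end Rescaling

/-! ### A Bessel inequality for almost orthogonal families -/

section Bessel

open scoped ComplexConjugate InnerProductSpace

/-- **Bessel inequality** for a finite almost orthogonal family `φ`: the Gram matrix is controlled
by Schur's test. -/
theorem sum_norm_integral_smul_sq_le {Ω ι H : Type*} [MeasurableSpace Ω] {μ : Measure Ω}
    [NormedAddCommGroup H] [InnerProductSpace ℂ H] [CompleteSpace H] {I : Finset ι}
    {φ : ι → Ω → ℂ} {g : Ω → H} {w : ι → ℝ} {C : ℝ} (hC : 0 < C) (hw : ∀ i ∈ I, 0 < w i)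
    (hφg : ∀ i ∈ I, Integrable (fun x => φ i x • g x) μ)
    (hφφ : ∀ i ∈ I, ∀ j ∈ I, Integrable (fun x => φ i x * conj (φ j x)) μ)
    (hg : Integrable (fun x => ‖g x‖ ^ 2) μ)
    (hG : ∀ i ∈ I, ∑ j ∈ I, ‖∫ x, φ i x * conj (φ j x) ∂μ‖ ≤ C * w i) :
    ∑ i ∈ I, ‖∫ x, φ i x • g x ∂μ‖ ^ 2 / w i ≤ C * ∫ x, ‖g x‖ ^ 2 ∂μ := by
  set a : ι → H := fun i => ∫ x, φ i x • g x ∂μ with ha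
  set b : ι → H := fun i => ((w i)⁻¹ : ℂ) • a i with hb
  set S : ℝ := ∑ i ∈ I, ‖a i‖ ^ 2 / w i with hS
  set v : Ω → H := fun x => ∑ i ∈ I, conj (φ i x) • b i with hv
  set G : ι → ι → ℝ := fun i j => ‖∫ x, φ i x * conj (φ j x) ∂μ‖ with hGdef
  have hvg : ∀ x, ⟪v x, g x⟫_ℂ = ∑ i ∈ I, ⟪b i, φ i x • g x⟫_ℂ := by
    intro x
    simp only [hv, sum_inner, inner_smul_left, inner_smul_right, Complex.conj_conj]
  have hvgi : Integrable (fun x => ⟪v x, g x⟫_ℂ) μ := by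
    simp only [hvg]
    exact integrable_finsetSum _ fun i hi => (hφg i hi).const_inner (b i)
  have hSint : ((S : ℝ) : ℂ) = ∫ x, ⟪v x, g x⟫_ℂ ∂μ := by
    simp only [hvg]
    rw [integral_finsetSum _ fun i hi => (hφg i hi).const_inner (b i), hS, Complex.ofReal_sum]
    refine Finset.sum_congr rfl fun i hi => ?_
    rw [integral_inner (hφg i hi), hb, inner_smul_left, inner_self_eq_norm_sq_to_K]
    simp only [map_inv₀, Complex.conj_ofReal]
    push_cast
    rw [div_eq_inv_mul]
    rfl
  have hvv : ∀ x, ((‖v x‖ ^ 2 : ℝ) : ℂ)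
      = ∑ i ∈ I, ∑ j ∈ I, φ i x * conj (φ j x) * ⟪b i, b j⟫_ℂ := by
    intro x
    have h0 : ((‖v x‖ ^ 2 : ℝ) : ℂ) = ⟪v x, v x⟫_ℂ := by
      rw [inner_self_eq_norm_sq_to_K]
      push_cast
      rfl
    rw [h0]
    simp only [hv]
    rw [sum_inner]
    simp only [inner_sum, inner_smul_left, inner_smul_right, Complex.conj_conj]
    refine Finset.sum_congr rfl fun i _ => ?_
    refine Finset.sum_congr rfl fun j _ => ?_
    ring
  have hvvi : Integrable (fun x => ((‖v x‖ ^ 2 : ℝ) : ℂ)) μ := by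
    simp only [hvv]
    exact integrable_finsetSum _ fun i hi => integrable_finsetSum _ fun j hj =>
      (hφφ i hi j hj).mul_const _
  have hvvr : Integrable (fun x => ‖v x‖ ^ 2) μ := by
    exact hvvi.re.congr (Filter.Eventually.of_forall fun x => Complex.ofReal_re _)
  have hV : ∫ x, ‖v x‖ ^ 2 ∂μ ≤ C * S := by
    have h1 : ((∫ x, ‖v x‖ ^ 2 ∂μ : ℝ) : ℂ)
        = ∑ i ∈ I, ∑ j ∈ I, (∫ x, φ i x * conj (φ j x) ∂μ) * ⟪b i, b j⟫_ℂ := by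
      rw [← integral_complex_ofReal]
      simp only [hvv]
      rw [integral_finsetSum _ fun i hi => integrable_finsetSum _ fun j hj =>
        (hφφ i hi j hj).mul_const _]
      refine Finset.sum_congr rfl fun i hi => ?_
      rw [integral_finsetSum _ fun j hj => (hφφ i hi j hj).mul_const _]
      exact Finset.sum_congr rfl fun j _ => integral_mul_const _ _
    have h2 : ∫ x, ‖v x‖ ^ 2 ∂μ ≤ ∑ i ∈ I, ∑ j ∈ I, G i j * (‖b i‖ * ‖b j‖) := by
      refine (Real.le_norm_self _).trans ?_
      rw [← Complex.norm_real, h1]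
      refine (norm_sum_le _ _).trans (Finset.sum_le_sum fun i _ => ?_)
      refine (norm_sum_le _ _).trans (Finset.sum_le_sum fun j _ => ?_)
      rw [norm_mul]
      gcongr
      exact norm_inner_le_norm _ _
    have hsymm : ∀ i j, G i j = G j i := by
      intro i j
      simp only [hGdef]
      rw [← Complex.norm_conj, ← integral_conj]
      congr 2
      funext x
      rw [map_mul, Complex.conj_conj, mul_comm]
    have h3 : ∑ i ∈ I, ∑ j ∈ I, G i j * (‖b i‖ * ‖b j‖)
        ≤ ∑ i ∈ I, ∑ j ∈ I, G i j * ‖b i‖ ^ 2 := by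
      have h4 : ∑ i ∈ I, ∑ j ∈ I, G i j * ‖b j‖ ^ 2 = ∑ i ∈ I, ∑ j ∈ I, G i j * ‖b i‖ ^ 2 := by
        rw [Finset.sum_comm]
        exact Finset.sum_congr rfl fun i _ => Finset.sum_congr rfl fun j _ => by rw [hsymm j i]
      have h5 : ∑ i ∈ I, ∑ j ∈ I, G i j * (‖b i‖ * ‖b j‖) ≤
          ∑ i ∈ I, ∑ j ∈ I, ((1 / 2) * (G i j * ‖b i‖ ^ 2) + (1 / 2) * (G i j * ‖b j‖ ^ 2)) := by
        refine Finset.sum_le_sum fun i _ => Finset.sum_le_sum fun j _ => ?_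
        have hG0 : 0 ≤ G i j := norm_nonneg _
        nlinarith [mul_nonneg hG0 (sq_nonneg (‖b i‖ - ‖b j‖))]
      simp only [Finset.sum_add_distrib, ← Finset.mul_sum] at h5
      linarith
    refine h2.trans (h3.trans ?_)
    rw [hS, Finset.mul_sum]
    refine Finset.sum_le_sum fun i hi => ?_
    have hwi := hw i hi
    have hbi : ‖b i‖ = ‖a i‖ / w i := by
      rw [hb, norm_smul, norm_inv, Complex.norm_real, Real.norm_of_nonneg hwi.le, div_eq_inv_mul]
    rw [← Finset.sum_mul]
    calc (∑ j ∈ I, G i j) * ‖b i‖ ^ 2 ≤ (C * w i) * ‖b i‖ ^ 2 := by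
          gcongr
          exact hG i hi
      _ = C * (‖a i‖ ^ 2 / w i) := by
          rw [hbi]; field_simp
  have hre : S = ∫ x, (⟪v x, g x⟫_ℂ).re ∂μ := by
    have h6 := integral_re hvgi
    have h7 := congrArg Complex.re hSint
    rw [Complex.ofReal_re] at h7
    exact h7.trans h6.symm
  -- The weights `C⁻¹` and `C` are chosen so that `hV` absorbs half of `S`.
  have hle : S ≤ ∫ x, ((1 / 2) * C⁻¹ * ‖v x‖ ^ 2 + (1 / 2) * C * ‖g x‖ ^ 2) ∂μ := by
    rw [hre]
    refine integral_mono hvgi.re ((hvvr.const_mul _).add (hg.const_mul _)) fun x => ?_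
    have h8 : (⟪v x, g x⟫_ℂ).re ≤ ‖v x‖ * ‖g x‖ :=
      (Complex.re_le_norm _).trans (norm_inner_le_norm _ _)
    refine h8.trans ?_
    have h9 : 0 ≤ C⁻¹ * (‖v x‖ - C * ‖g x‖) ^ 2 := by positivity
    have h10 : C⁻¹ * (‖v x‖ - C * ‖g x‖) ^ 2
        = C⁻¹ * ‖v x‖ ^ 2 - 2 * (‖v x‖ * ‖g x‖) + C * ‖g x‖ ^ 2 := by field_simp; ring
    linarith
  rw [integral_add (hvvr.const_mul _) (hg.const_mul _), integral_const_mul, integral_const_mul]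
    at hle
  have h11 : 1 / 2 * C⁻¹ * ∫ x, ‖v x‖ ^ 2 ∂μ ≤ 1 / 2 * S := by
    calc 1 / 2 * C⁻¹ * ∫ x, ‖v x‖ ^ 2 ∂μ ≤ 1 / 2 * C⁻¹ * (C * S) := by gcongr
      _ = 1 / 2 * S := by field_simp
  linarith

end Bessel

/-! ### Counting cubes -/

section Cubes

open scoped ComplexConjugate

variable {d : ℕ}

theorem norm_le_of_forall_abs_le {x : RSpace d} {t : ℝ} (ht : 0 ≤ t) (h : ∀ i, |x i| ≤ t) :
    ‖x‖ ≤ d * t := by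
  rw [EuclideanSpace.norm_eq]
  refine Real.sqrt_le_iff.2 ⟨by positivity, ?_⟩
  calc ∑ i, ‖x i‖ ^ 2 ≤ ∑ _i : Fin d, t ^ 2 := by
        refine Finset.sum_le_sum fun i _ => ?_
        rw [Real.norm_eq_abs]
        exact pow_le_pow_left₀ (abs_nonneg _) (h i) 2
    _ = d * t ^ 2 := by simp
    _ ≤ (d * t) ^ 2 := by
        rw [mul_pow]
        gcongr
        have : d ≤ d ^ 2 := Nat.le_self_pow (by norm_num) d
        exact_mod_cast this

namespace DyadicLattice

variable (D : DyadicLattice d)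

theorem side_pos (Q : DyadicIndex d) : 0 < D.side Q :=
  mul_pos D.scale_pos (by positivity)

theorem norm_sub_center_le_of_mem_closure_tripleCube {Q : DyadicIndex d} {x : RSpace d}
    (hx : x ∈ closure (D.tripleCube Q)) : ‖x - D.center Q‖ ≤ (d * 2) * D.side Q := by
  have hQ := D.side_pos Q
  have hcl : closure (D.tripleCube Q) ⊆ {x | ∀ i, |x i - D.center Q i| ≤ 3 * D.side Q / 2} := by
    refine closure_minimal (fun x hx i => (hx i).le) ?_
    simp only [Set.ofPred_forall]
    refine isClosed_iInter fun i => ?_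
    exact isClosed_le (by fun_prop) continuous_const
  rw [mul_assoc]
  refine norm_le_of_forall_abs_le (by positivity) fun i => ?_
  have := hcl hx i
  rw [PiLp.sub_apply]
  linarith

theorem center_mem_cube (Q : DyadicIndex d) : D.center Q ∈ D.cube Q := fun i => by
  have := D.side_pos Q
  rw [sub_self, abs_zero]
  positivity

theorem norm_center_sub_center_le {Q P : DyadicIndex d} (h : D.cube Q ⊆ D.cube P) :
    ‖D.center Q - D.center P‖ ≤ d * D.side P := by
  have hP := D.side_pos P
  refine norm_le_of_forall_abs_le hP.le fun i => ?_
  have := h (D.center_mem_cube Q) i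
  rw [PiLp.sub_apply]
  linarith

theorem side_le_side (hd : 0 < d) {Q P : DyadicIndex d} (h : D.cube Q ⊆ D.cube P) :
    D.side Q ≤ D.side P := by
  have hQ := D.side_pos Q
  refine le_of_forall_lt fun t ht => ?_
  rcases lt_or_ge t 0 with ht0 | ht0
  · exact ht0.trans (D.side_pos P)
  let i : Fin d := ⟨0, hd⟩
  have key : ∀ σ : ℝ, |σ| < D.side Q / 2 →
      |D.center Q i + σ - D.center P i| < D.side P / 2 := by
    intro σ hσ
    have hmem : D.center Q + EuclideanSpace.single i σ ∈ D.cube Q := by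
      intro j
      rw [PiLp.add_apply, add_sub_cancel_left]
      by_cases hj : j = i
      · subst hj; simpa using hσ
      · simp [hj, hQ]
    have := h hmem i
    simpa using this
  have h1 := (abs_lt.1 (key (t / 2) (by rw [abs_of_nonneg (by positivity)]; linarith))).2
  have h2 := (abs_lt.1 (key (-(t / 2))
    (by rw [abs_neg, abs_of_nonneg (by positivity)]; linarith))).1
  linarith

/-- The balls of radius `B ℓ(Q)` about the centres of the cubes `Q` of one generation have bounded
overlap. -/
theorem card_filter_near_le (I : Finset (DyadicIndex d)) (k : ℤ) (x : RSpace d) (B : ℝ) :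
    (I.filter fun Q => Q.1 = k ∧ ‖x - D.center Q‖ < B * D.side Q).card
      ≤ (⌈2 * B⌉₊ + 1) ^ d := by
  classical
  set ℓ : ℝ := D.scale * (2 : ℝ) ^ k with hℓ
  have hℓ0 : 0 < ℓ := mul_pos D.scale_pos (by positivity)
  let t : Fin d → ℝ := fun i => (x i - D.origin k i) / ℓ - 1 / 2
  let J : Finset (Fin d → ℤ) := Fintype.piFinset fun i => Finset.Icc ⌈t i - B⌉ ⌊t i + B⌋
  have hcard : J.card ≤ (⌈2 * B⌉₊ + 1) ^ d := by
    rw [Fintype.card_piFinset]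
    refine (Finset.prod_le_pow_card _ _ (⌈2 * B⌉₊ + 1) fun i _ => ?_).trans (by simp)
    rw [Int.card_Icc, Int.toNat_le]
    have h1 := Int.floor_le (t i + B)
    have h2 := Int.le_ceil (t i - B)
    have h3 := Nat.le_ceil (2 * B)
    have : ((⌊t i + B⌋ : ℤ) : ℝ) + 1 - ⌈t i - B⌉ ≤ (⌈2 * B⌉₊ : ℝ) + 1 := by linarith
    exact_mod_cast this
  refine le_trans (Finset.card_le_card_of_injOn (fun Q => Q.2) ?_ ?_) hcard
  · rintro ⟨k', n⟩ hQ
    obtain ⟨-, rfl, hQx⟩ := Finset.mem_filter.1 hQ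
    simp only [J, Finset.mem_coe, Fintype.mem_piFinset, Finset.mem_Icc]
    intro i
    have h1 : |x i - D.center (k', n) i| < B * ℓ := by
      refine lt_of_le_of_lt ?_ hQx
      exact PiLp.norm_apply_le (x - D.center (k', n)) i
    have h2 : x i - D.center (k', n) i = ℓ * (t i - n i) := by
      simp only [t, center, side]
      rw [← hℓ]
      field_simp
      ring
    rw [h2, abs_mul, abs_of_pos hℓ0, mul_comm, mul_lt_mul_iff_left₀ hℓ0, abs_lt] at h1
    constructor
    · rw [Int.ceil_le]; linarith [h1.2]
    · rw [Int.le_floor]; linarith [h1.1]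
  · rintro ⟨k₁, n₁⟩ h1 ⟨k₂, n₂⟩ h2 h
    have e1 := (Finset.mem_filter.1 h1).2.1
    have e2 := (Finset.mem_filter.1 h2).2.1
    exact Prod.ext (e1.trans e2.symm) h

end DyadicLattice

/-- Sets with overlap at most `N` inside `T` have total measure at most `N μ(T)`. -/
theorem sum_measure_le_of_card_le {Ω ι : Type*} [MeasurableSpace Ω] (μ : Measure Ω) (J : Finset ι)
    {S : ι → Set Ω} (hS : ∀ i, MeasurableSet (S i)) {T : Set Ω} (hT : MeasurableSet T)
    (hST : ∀ i ∈ J, S i ⊆ T) [∀ x i, Decidable (x ∈ S i)] {N : ℕ}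
    (hN : ∀ x, (J.filter fun i => x ∈ S i).card ≤ N) : ∑ i ∈ J, μ (S i) ≤ N * μ T := by
  calc ∑ i ∈ J, μ (S i) = ∑ i ∈ J, ∫⁻ x, (S i).indicator 1 x ∂μ :=
        Finset.sum_congr rfl fun i _ => (lintegral_indicator_one (hS i)).symm
    _ = ∫⁻ x, ∑ i ∈ J, (S i).indicator 1 x ∂μ := by
        rw [lintegral_finsetSum]
        exact fun i _ => measurable_one.indicator (hS i)
    _ ≤ ∫⁻ x, N * T.indicator 1 x ∂μ := by
        refine lintegral_mono fun x => ?_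
        by_cases hx : x ∈ T
        · have : ∑ i ∈ J, (S i).indicator (1 : Ω → ℝ≥0∞) x = (J.filter fun i => x ∈ S i).card := by
            simp [Set.indicator_apply]
          rw [this, Set.indicator_of_mem hx, Pi.one_apply, mul_one]
          exact Nat.cast_le.2 (hN x)
        · rw [Finset.sum_eq_zero]
          · exact zero_le
          · intro i hi
            exact Set.indicator_of_notMem (fun h => hx (hST i hi h)) _
    _ = N * μ T := by
        rw [lintegral_const_mul _ (measurable_one.indicator hT), lintegral_indicator_one hT]

end Cubes

/-! ### Almost orthogonality of adapted bumps -/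

section Adapted

open scoped ComplexConjugate

variable {d s : ℕ} {Λ A : ℝ} {μ : Measure (RSpace d)}

/-- A bump of `μ`-mean zero adapted to the ball `B(c, A t)` at scale `t`. -/
structure IsAdapted (μ : Measure (RSpace d)) (A : ℝ) (c : RSpace d) (t : ℝ) (f : RSpace d → ℂ) :
    Prop where
  lip : ∀ x y, ‖f x - f y‖ ≤ t⁻¹ * ‖x - y‖
  bound : ∀ x, ‖f x‖ ≤ 1
  eq_zero : ∀ x, A * t ≤ ‖x - c‖ → f x = 0
  integral_eq_zero : ∫ x, f x ∂μ = 0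

namespace IsAdapted

variable {c c' : RSpace d} {t t' : ℝ} {f g : RSpace d → ℂ}

theorem isLipBump (hf : IsAdapted μ A c t f) : IsLipBump t⁻¹ 1 (‖c‖ + A * t) f where
  lip := hf.lip
  bound := hf.bound
  eq_zero x hx := hf.eq_zero x (by
    have := norm_le_norm_add_norm_sub c x
    rw [norm_sub_rev] at this
    linarith)

/-- The mean value zero of `g` gains the factor `t'/t`. It is used when `g` lives at the smaller
scale. -/
theorem norm_integral_mul_conj_le [IsLocallyFiniteMeasure μ] (hf : IsAdapted μ A c t f)
    (hg : IsAdapted μ A c' t' g) (hA : 0 < A) (ht : 0 < t) (ht' : 0 < t') :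
    ‖∫ x, f x * conj (g x) ∂μ‖ ≤ A * (t' / t) * μ.real (Metric.ball c' (A * t')) := by
  have bf := hf.isLipBump
  have bg := hg.isLipBump
  have hgc : Continuous fun x => conj (g x) := Complex.continuous_conj.comp bg.continuous
  have hgs : HasCompactSupport fun x => conj (g x) := bg.hasCompactSupport.comp_left (map_zero _)
  have i1 : Integrable (fun x => f x * conj (g x)) μ :=
    (bf.continuous.mul hgc).integrable_of_hasCompactSupport hgs.mul_left
  have i2 : Integrable (fun x => f c' * conj (g x)) μ :=
    (hgc.integrable_of_hasCompactSupport hgs).const_mul _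
  have e : ∫ x, f x * conj (g x) ∂μ = ∫ x, (f x - f c') * conj (g x) ∂μ := by
    simp only [sub_mul]
    rw [integral_sub i1 i2, integral_const_mul, integral_conj, hg.integral_eq_zero, map_zero,
      mul_zero, sub_zero]
  rw [e]
  refine norm_integral_le_of_eq_zero_off_ball (x₀ := c') (R := A * t') (fun x => ?_)
    ENNReal.toReal_nonneg ?_ fun x hx => ?_
  · rw [norm_mul, Complex.norm_conj]
    rcases le_or_gt (A * t') ‖x - c'‖ with h | h
    · rw [hg.eq_zero x h, norm_zero, mul_zero]; positivity
    · calc ‖f x - f c'‖ * ‖g x‖ ≤ (t⁻¹ * ‖x - c'‖) * 1 := by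
            gcongr
            · exact hf.lip _ _
            · exact hg.bound x
        _ ≤ (t⁻¹ * (A * t')) * 1 := by gcongr
        _ = A * (t' / t) := by rw [mul_one, div_eq_inv_mul]; ring
  · exact (ENNReal.ofReal_toReal measure_ball_lt_top.ne).ge
  · rw [Metric.mem_ball, not_lt, dist_eq_norm] at hx
    rw [hg.eq_zero x hx, map_zero, mul_zero]

theorem integral_mul_conj_eq_zero (hf : IsAdapted μ A c t f) (hg : IsAdapted μ A c' t' g)
    (h : A * t + A * t' ≤ ‖c - c'‖) : ∫ x, f x * conj (g x) ∂μ = 0 := by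
  have : ∀ x, f x * conj (g x) = 0 := by
    intro x
    rcases le_or_gt (A * t) ‖x - c‖ with h1 | h1
    · rw [hf.eq_zero x h1, zero_mul]
    · have h2 : A * t' ≤ ‖x - c'‖ := by
        have h3 := norm_sub_le_norm_sub_add_norm_sub c x c'
        rw [norm_sub_rev c x] at h3
        linarith
      rw [hg.eq_zero x h2, map_zero, mul_zero]
  simp only [this, integral_zero]

theorem norm_integral_mul_conj_comm (f g : RSpace d → ℂ) :
    ‖∫ x, f x * conj (g x) ∂μ‖ = ‖∫ x, g x * conj (f x) ∂μ‖ := by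
  rw [← Complex.norm_conj, ← integral_conj]
  congr 2
  funext x
  rw [map_mul, Complex.conj_conj, mul_comm]

end IsAdapted

namespace DyadicLattice

variable (D : DyadicLattice d) {φ : DyadicIndex d → RSpace d → ℂ} {I : Finset (DyadicIndex d)}

theorem side_eq_mul_of_add {Q Q' : DyadicIndex d} {n : ℕ} (h : Q.1 + n = Q'.1) :
    D.side Q = (1 / 2) ^ n * D.side Q' := by
  rw [side, side, ← h, zpow_add₀ (by norm_num), zpow_natCast, one_div, inv_pow]
  field_simp

/-- The entries of a row of the Gram matrix that come from one generation decay geometrically in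
the distance between the generations. -/
theorem sum_generation_norm_integral_le [IsLocallyFiniteMeasure μ] (hμ : IsNiceWith s Λ μ)
    (hΛ : 0 ≤ Λ) (hA : 0 < A) (hφ : ∀ Q ∈ I, IsAdapted μ A (D.center Q) (D.side Q) (φ Q))
    {Q : DyadicIndex d} (hQ : Q ∈ I) (j : ℤ) :
    ∑ Q' ∈ I.filter (fun Q' => Q'.1 = j), ‖∫ x, φ Q x * conj (φ Q' x) ∂μ‖
      ≤ A * ((⌈2 * (2 * A)⌉₊ + 1) ^ d : ℕ) * (Λ * (3 * A) ^ s) * D.side Q ^ s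
        * (1 / 2) ^ (j - Q.1).natAbs := by
  classical
  have hℓ := D.side_pos Q
  set N : ℕ := (⌈2 * (2 * A)⌉₊ + 1) ^ d with hN
  set J := I.filter fun Q' => Q'.1 = j ∧ ‖D.center Q - D.center Q'‖ < A * D.side Q + A * D.side Q'
    with hJ
  have hmeas : ∀ r : ℝ, 0 < r → μ.real (Metric.ball (D.center Q) r) ≤ Λ * r ^ s := fun r hr =>
    ENNReal.toReal_le_of_le_ofReal (by positivity) (hμ _ r hr)
  have h1 : ∑ Q' ∈ I.filter (fun Q' => Q'.1 = j), ‖∫ x, φ Q x * conj (φ Q' x) ∂μ‖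
      = ∑ Q' ∈ J, ‖∫ x, φ Q x * conj (φ Q' x) ∂μ‖ := by
    rw [hJ, ← Finset.filter_filter]
    refine (Finset.sum_filter_of_ne fun Q' hQ' hne => ?_).symm
    by_contra hcon
    refine hne ?_
    rw [(hφ Q hQ).integral_mul_conj_eq_zero (hφ Q' (Finset.mem_filter.1 hQ').1) (not_lt.1 hcon),
      norm_zero]
  rw [h1]
  rcases le_total j Q.1 with hj | hj
  -- Smaller cubes `Q'` may be very many: their balls have bounded overlap inside `B(x_Q, 3Aℓ(Q))`.
  · obtain ⟨n, hn⟩ := Int.le.dest hj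
    have hnat : (j - Q.1).natAbs = n := by omega
    rw [hnat]
    have hside : ∀ Q' ∈ J, D.side Q' = (1 / 2) ^ n * D.side Q := by
      intro Q' hQ'
      have e := (Finset.mem_filter.1 hQ').2.1
      exact D.side_eq_mul_of_add (by rw [e]; exact hn)
    have hsle : ∀ Q' ∈ J, D.side Q' ≤ D.side Q := by
      intro Q' hQ'
      rw [hside Q' hQ']
      exact mul_le_of_le_one_left hℓ.le (pow_le_one₀ (by norm_num) (by norm_num))
    have hterm : ∀ Q' ∈ J, ‖∫ x, φ Q x * conj (φ Q' x) ∂μ‖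
        ≤ A * (1 / 2) ^ n * μ.real (Metric.ball (D.center Q') (A * D.side Q')) := by
      intro Q' hQ'
      have h2 := (hφ Q hQ).norm_integral_mul_conj_le (hφ Q' (Finset.mem_filter.1 hQ').1) hA hℓ
        (D.side_pos Q')
      have h3 : D.side Q' / D.side Q = (1 / 2) ^ n := by
        rw [hside Q' hQ', mul_div_assoc, div_self hℓ.ne', mul_one]
      rwa [h3] at h2
    have hover : ∑ Q' ∈ J, μ.real (Metric.ball (D.center Q') (A * D.side Q'))
        ≤ N * μ.real (Metric.ball (D.center Q) (3 * A * D.side Q)) := by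
      have h4 := sum_measure_le_of_card_le μ J (N := N)
        (S := fun Q' => Metric.ball (D.center Q') (A * D.side Q'))
        (T := Metric.ball (D.center Q) (3 * A * D.side Q))
        (fun _ => Metric.isOpen_ball.measurableSet) Metric.isOpen_ball.measurableSet
        (fun Q' hQ' => by
          refine Metric.ball_subset_ball' ?_
          rw [dist_comm, dist_eq_norm]
          have h5 := (Finset.mem_filter.1 hQ').2.2
          have h6 := mul_le_mul_of_nonneg_left (hsle Q' hQ') hA.le
          linarith)
        (fun x => by
          refine le_trans (Finset.card_le_card ?_) (D.card_filter_near_le I j x (2 * A))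
          intro Q' hQ'
          obtain ⟨hQ'J, hx⟩ := Finset.mem_filter.1 hQ'
          obtain ⟨hQ'I, hQ'j, -⟩ := Finset.mem_filter.1 hQ'J
          refine Finset.mem_filter.2 ⟨hQ'I, hQ'j, ?_⟩
          rw [Metric.mem_ball, dist_eq_norm] at hx
          have := mul_pos hA (D.side_pos Q')
          linarith)
      have h7 := ENNReal.toReal_mono
        (ENNReal.mul_ne_top (ENNReal.natCast_ne_top N) measure_ball_lt_top.ne) h4
      rw [ENNReal.toReal_sum fun _ _ => measure_ball_lt_top.ne, ENNReal.toReal_mul,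
        ENNReal.toReal_natCast] at h7
      exact h7
    calc ∑ Q' ∈ J, ‖∫ x, φ Q x * conj (φ Q' x) ∂μ‖
        ≤ ∑ Q' ∈ J, A * (1 / 2) ^ n * μ.real (Metric.ball (D.center Q') (A * D.side Q')) :=
          Finset.sum_le_sum hterm
      _ = A * (1 / 2) ^ n * ∑ Q' ∈ J, μ.real (Metric.ball (D.center Q') (A * D.side Q')) := by
          rw [Finset.mul_sum]
      _ ≤ A * (1 / 2) ^ n * (N * (Λ * (3 * A * D.side Q) ^ s)) := by
          gcongr
          exact hover.trans (by gcongr; exact hmeas _ (by positivity))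
      _ = _ := by rw [mul_pow (3 * A)]; ring
  -- Larger cubes `Q'` of one generation near `Q` are boundedly many.
  · obtain ⟨n, hn⟩ := Int.le.dest hj
    have hnat : (j - Q.1).natAbs = n := by omega
    rw [hnat]
    have hside : ∀ Q' ∈ J, D.side Q = (1 / 2) ^ n * D.side Q' := by
      intro Q' hQ'
      have e := (Finset.mem_filter.1 hQ').2.1
      exact D.side_eq_mul_of_add (by rw [e]; exact hn)
    have hterm : ∀ Q' ∈ J, ‖∫ x, φ Q x * conj (φ Q' x) ∂μ‖
        ≤ A * (1 / 2) ^ n * (Λ * (A * D.side Q) ^ s) := by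
      intro Q' hQ'
      rw [IsAdapted.norm_integral_mul_conj_comm]
      have h2 := (hφ Q' (Finset.mem_filter.1 hQ').1).norm_integral_mul_conj_le (hφ Q hQ) hA
        (D.side_pos Q') hℓ
      have h3 : D.side Q / D.side Q' = (1 / 2) ^ n := by
        rw [hside Q' hQ', mul_div_assoc, div_self (D.side_pos Q').ne', mul_one]
      rw [h3] at h2
      refine h2.trans ?_
      gcongr
      exact hmeas _ (by positivity)
    have hcard : J.card ≤ N := by
      refine le_trans (Finset.card_le_card ?_)
        (D.card_filter_near_le I j (D.center Q) (2 * A))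
      intro Q' hQ'
      obtain ⟨hQ'I, hQ'j, hnear⟩ := Finset.mem_filter.1 hQ'
      refine Finset.mem_filter.2 ⟨hQ'I, hQ'j, ?_⟩
      have h5 : D.side Q ≤ D.side Q' := by
        rw [hside Q' hQ']
        exact mul_le_of_le_one_left (D.side_pos Q').le (pow_le_one₀ (by norm_num) (by norm_num))
      have h6 := mul_le_mul_of_nonneg_left h5 hA.le
      linarith
    calc ∑ Q' ∈ J, ‖∫ x, φ Q x * conj (φ Q' x) ∂μ‖
        ≤ J.card • (A * (1 / 2) ^ n * (Λ * (A * D.side Q) ^ s)) :=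
          Finset.sum_le_card_nsmul _ _ _ hterm
      _ ≤ N * (A * (1 / 2) ^ n * (Λ * ((3 * A) * D.side Q) ^ s)) := by
          rw [nsmul_eq_mul]
          gcongr
          linarith
      _ = _ := by rw [mul_pow (3 * A)]; ring

theorem summable_half_pow_natAbs : Summable fun j : ℤ => (1 / 2 : ℝ) ^ j.natAbs := by
  refine Summable.of_nat_of_neg ?_ ?_
  · simpa using summable_geometric_two
  · simpa using summable_geometric_two

theorem sum_comp_sub_le_tsum {f : ℤ → ℝ} (hf : Summable f) (hf0 : ∀ j, 0 ≤ f j) (T : Finset ℤ)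
    (k : ℤ) : ∑ j ∈ T, f (j - k) ≤ ∑' j, f j := by
  have h1 : Summable fun j => f (j - k) := (Equiv.subRight k).summable_iff.2 hf
  have h2 : ∑' j, f (j - k) = ∑' j, f j := (Equiv.subRight k).tsum_eq f
  rw [← h2]
  exact h1.sum_le_tsum T fun j _ => hf0 _

/-- The rows of the Gram matrix of a family of adapted bumps are bounded by `ℓ(Q)^s`. -/
theorem exists_sum_norm_integral_le (hΛ : 0 ≤ Λ) (hA : 0 < A) (s : ℕ) :
    ∃ C : ℝ, 0 < C ∧ ∀ (μ : Measure (RSpace d)) (_ : IsLocallyFiniteMeasure μ),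
      IsNiceWith s Λ μ → ∀ (φ : DyadicIndex d → RSpace d → ℂ) (I : Finset (DyadicIndex d)),
      (∀ Q ∈ I, IsAdapted μ A (D.center Q) (D.side Q) (φ Q)) → ∀ Q ∈ I,
      ∑ Q' ∈ I, ‖∫ x, φ Q x * conj (φ Q' x) ∂μ‖ ≤ C * D.side Q ^ s := by
  classical
  set C₀ : ℝ := A * ((⌈2 * (2 * A)⌉₊ + 1) ^ d : ℕ) * (Λ * (3 * A) ^ s) with hC₀
  set S : ℝ := ∑' j : ℤ, (1 / 2 : ℝ) ^ j.natAbs with hS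
  have hS0 : 0 ≤ S := tsum_nonneg fun j => by positivity
  refine ⟨C₀ * S + 1, by positivity, fun μ _ hμ φ I hφ Q hQ => ?_⟩
  have hℓ := D.side_pos Q
  rw [← Finset.sum_fiberwise_of_maps_to (s := I) (t := I.image Prod.fst) (g := Prod.fst)
    fun Q' hQ' => Finset.mem_image_of_mem _ hQ']
  calc _ ≤ ∑ j ∈ I.image Prod.fst, C₀ * D.side Q ^ s * (1 / 2) ^ (j - Q.1).natAbs :=
        Finset.sum_le_sum fun j _ => D.sum_generation_norm_integral_le hμ hΛ hA hφ hQ j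
    _ = C₀ * D.side Q ^ s * ∑ j ∈ I.image Prod.fst, (1 / 2) ^ (j - Q.1).natAbs := by
        rw [Finset.mul_sum]
    _ ≤ C₀ * D.side Q ^ s * S := by
        gcongr
        exact sum_comp_sub_le_tsum summable_half_pow_natAbs (fun j => by positivity) _ Q.1
    _ ≤ (C₀ * S + 1) * D.side Q ^ s := by
        have : 0 ≤ D.side Q ^ s := by positivity
        linarith

end DyadicLattice

end Adapted

/-! ### The Carleson condition -/

section Carleson

open Filter Topology
open scoped ComplexConjugate

variable {d d' s : ℕ} {α Λ : ℝ} {K : RSpace d → CSpace d'} {μ : Measure (RSpace d)}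

theorem integral_norm_sq_eq {E : Type*} [NormedAddCommGroup E] {g : RSpace d → E}
    (hg : MemLp g 2 μ) : ∫ x, ‖g x‖ ^ 2 ∂μ = (eLpNorm g 2 μ).toReal ^ 2 := by
  have h0 : 0 ≤ ∫ x, ‖g x‖ ^ 2 ∂μ := integral_nonneg fun x => by positivity
  rw [hg.eLpNorm_eq_integral_rpow_norm (by norm_num) (by norm_num)]
  simp only [ENNReal.toReal_ofNat, Real.rpow_ofNat]
  rw [ENNReal.toReal_ofReal (by positivity), ← Real.rpow_natCast, ← Real.rpow_mul h0]
  norm_num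

/-- The truncated pairing is the integral against the truncated operator. -/
theorem integral_smul_regOperator [IsLocallyFiniteMeasure μ] (hK : IsCZKernel s α K) {ε : ℝ}
    (hε : 0 < ε) {f χ : RSpace d → ℂ} (hf : IsLipZero f) (hχ : IsLipZero χ) :
    Integrable (fun x => f x • regOperator s α K μ ε χ x) μ ∧
      lipPairing (regKernel s α K ε) μ χ f = ∫ x, f x • regOperator s α K μ ε χ x ∂μ := by
  obtain ⟨L, A, R₁, -, -, bf⟩ := hf.exists_isLipBump
  obtain ⟨L', A', R₂, -, -, bχ⟩ := hχ.exists_isLipBump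
  refine lipPairing_eq_integral_of_integrable (fun x _ => hK.regKernel_neg ε x)
    (fun x => by rw [hK.regKernel_zero, smul_zero]) ?_
  have h1 := bf.continuous
  have h2 := bχ.continuous
  refine Continuous.integrable_of_hasCompactSupport
    (((h2.comp continuous_snd).mul (h1.comp continuous_fst)).smul
      ((hK.continuous_regKernel hε).comp (continuous_fst.sub continuous_snd))) ?_
  refine HasCompactSupport.intro ((isCompact_closedBall (0 : RSpace d) R₁).prod
    (isCompact_closedBall (0 : RSpace d) R₂)) fun z hz => ?_
  have : f z.1 = 0 ∨ χ z.2 = 0 := by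
    by_contra! hc
    refine hz ⟨?_, ?_⟩
    · rw [mem_closedBall_zero_iff]
      exact (not_le.1 fun h => hc.1 (bf.eq_zero _ h)).le
    · rw [mem_closedBall_zero_iff]
      exact (not_le.1 fun h => hc.2 (bχ.eq_zero _ h)).le
  rcases this with h | h <;> simp [h]

theorem tendsto_lipPairing_regKernel [SFinite μ] (hs : 0 < s) (hK : IsCZKernel s α K)
    (hμ : IsNiceWith s Λ μ) (hΛ : 0 ≤ Λ) {f χ : RSpace d → ℂ} (hf : IsLipZero f)
    (hχ : IsLipZero χ) :
    Tendsto (fun ε => lipPairing (regKernel s α K ε) μ f χ) (𝓝[>] 0) (𝓝 (lipPairing K μ f χ)) := by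
  obtain ⟨L, A, R₁, hL, hR₁, bf⟩ := hf.exists_isLipBump
  obtain ⟨L', A', R₂, hL', hR₂, bχ⟩ := hχ.exists_isLipBump
  replace bf := bf.mono_radius (le_max_left R₁ R₂)
  replace bχ := bχ.mono_radius (le_max_right R₁ R₂)
  set R := max R₁ R₂
  rw [tendsto_iff_norm_sub_tendsto_zero]
  have hlim : Tendsto (fun ε : ℝ => 2 * (A * L' + A' * L) * (Λ * 3 ^ s * ε * (Λ * R ^ s)))
      (𝓝[>] 0) (𝓝 0) := by
    have : Continuous fun ε : ℝ => 2 * (A * L' + A' * L) * (Λ * 3 ^ s * ε * (Λ * R ^ s)) := by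
      fun_prop
    have h := this.tendsto 0
    simp only [mul_zero, zero_mul] at h
    exact h.mono_left nhdsWithin_le_nhds
  refine squeeze_zero' (Eventually.of_forall fun _ => norm_nonneg _) ?_ hlim
  filter_upwards [self_mem_nhdsWithin] with ε hε
  rw [norm_sub_rev]
  exact norm_lipPairing_sub_regKernel_le hs hK hμ hΛ bf bχ hL hL' (lt_max_of_lt_left hR₁) hε

/-- A finite family of adapted bumps on which the pairing with a common cutoff `χ` is large
satisfies a packing condition, by Bessel's inequality and the `L²`-boundedness of `T`. -/
theorem sum_side_pow_le [IsLocallyFiniteMeasure μ] (D : DyadicLattice d) (hs : 0 < s)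
    (hK : IsCZKernel s α K) (hμ : IsNiceWith s Λ μ) (hΛ : 0 ≤ Λ) {CT : ℝ≥0}
    (hT : ∀ δ : ℝ, 0 < δ → ∀ f : RSpace d → ℂ, MemLp f 2 μ →
      eLpNorm (regOperator s α K μ δ f) 2 μ ≤ CT * eLpNorm f 2 μ)
    {A C Δ : ℝ} (hC : 0 < C) (hΔ : 0 < Δ) {I : Finset (DyadicIndex d)}
    {φ : DyadicIndex d → RSpace d → ℂ}
    (hφ : ∀ Q ∈ I, IsAdapted μ A (D.center Q) (D.side Q) (φ Q))
    (hG : ∀ Q ∈ I, ∑ Q' ∈ I, ‖∫ x, φ Q x * conj (φ Q' x) ∂μ‖ ≤ C * D.side Q ^ s)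
    {χ : RSpace d → ℂ} (hχ : IsLipZero χ)
    (hlarge : ∀ Q ∈ I, Δ * D.side Q ^ s ≤ ‖lipPairing K μ (φ Q) χ‖) :
    ∑ Q ∈ I, D.side Q ^ s ≤ C * CT ^ 2 * (2 / Δ) ^ 2 * ∫ x, ‖χ x‖ ^ 2 ∂μ := by
  -- The `L²` bound concerns the truncations; choose one that serves all cubes of the finite family.
  obtain ⟨ε, hε, hεI⟩ : ∃ ε : ℝ, 0 < ε ∧ ∀ Q ∈ I,
      Δ / 2 * D.side Q ^ s ≤ ‖lipPairing (regKernel s α K ε) μ (φ Q) χ‖ := by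
    have hev : ∀ᶠ ε in 𝓝[>] (0 : ℝ), ∀ Q ∈ I,
        Δ / 2 * D.side Q ^ s ≤ ‖lipPairing (regKernel s α K ε) μ (φ Q) χ‖ := by
      rw [Filter.eventually_all_finset]
      intro Q hQ
      have hℓ := pow_pos (D.side_pos Q) s
      have hlt : Δ / 2 * D.side Q ^ s < ‖lipPairing K μ (φ Q) χ‖ :=
        lt_of_lt_of_le (by nlinarith) (hlarge Q hQ)
      have := (tendsto_lipPairing_regKernel hs hK hμ hΛ (hφ Q hQ).isLipBump.isLipZero hχ).norm
      exact (this.eventually (lt_mem_nhds hlt)).mono fun _ h => h.le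
    obtain ⟨ε, h1, h2⟩ := (hev.and self_mem_nhdsWithin).exists
    exact ⟨ε, h2, h1⟩
  set g := regOperator s α K μ ε χ with hgdef
  obtain ⟨_, _, _, -, -, bχ⟩ := hχ.exists_isLipBump
  have hχL : MemLp χ 2 μ := bχ.continuous.memLp_of_hasCompactSupport bχ.hasCompactSupport
  have hgL : MemLp g 2 μ :=
    ⟨(stronglyMeasurable_integral_kernel (hK.continuous_regKernel hε).measurable
      bχ.continuous).aestronglyMeasurable,
      (hT ε hε χ hχL).trans_lt (ENNReal.mul_lt_top ENNReal.coe_lt_top hχL.2)⟩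
  have hgsq : ∫ x, ‖g x‖ ^ 2 ∂μ ≤ CT ^ 2 * ∫ x, ‖χ x‖ ^ 2 ∂μ := by
    rw [integral_norm_sq_eq hgL, integral_norm_sq_eq hχL, ← mul_pow]
    have h3 := ENNReal.toReal_mono (ENNReal.mul_ne_top ENNReal.coe_ne_top hχL.2.ne) (hT ε hε χ hχL)
    rw [ENNReal.toReal_mul, ENNReal.coe_toReal] at h3
    gcongr
  have hbessel := sum_norm_integral_smul_sq_le (μ := μ) (I := I) (φ := φ) (g := g)
    (w := fun Q => D.side Q ^ s) (C := C) hC (fun Q _ => pow_pos (D.side_pos Q) s)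
    (fun Q hQ => (integral_smul_regOperator hK hε (hφ Q hQ).isLipBump.isLipZero hχ).1)
    (fun Q hQ Q' hQ' => by
      have b1 := (hφ Q hQ).isLipBump
      have b2 := (hφ Q' hQ').isLipBump
      exact (b1.continuous.mul (Complex.continuous_conj.comp
        b2.continuous)).integrable_of_hasCompactSupport b1.hasCompactSupport.mul_right)
    (by simpa using hgL.integrable_norm_pow (p := 2) (by norm_num)) hG
  have hterm : ∀ Q ∈ I, (Δ / 2) ^ 2 * D.side Q ^ s
      ≤ ‖∫ x, φ Q x • g x ∂μ‖ ^ 2 / D.side Q ^ s := by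
    intro Q hQ
    have hℓ := pow_pos (D.side_pos Q) s
    rw [← (integral_smul_regOperator hK hε (hφ Q hQ).isLipBump.isLipZero hχ).2, lipPairing_swap,
      norm_neg, le_div_iff₀ hℓ]
    calc (Δ / 2) ^ 2 * D.side Q ^ s * D.side Q ^ s = (Δ / 2 * D.side Q ^ s) ^ 2 := by ring
      _ ≤ _ := by
        gcongr
        exact hεI Q hQ
  have hsum := (Finset.sum_le_sum hterm).trans (hbessel.trans
    (mul_le_mul_of_nonneg_left hgsq hC.le))
  rw [← Finset.mul_sum] at hsum
  calc ∑ Q ∈ I, D.side Q ^ s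
      = (2 / Δ) ^ 2 * ((Δ / 2) ^ 2 * ∑ Q ∈ I, D.side Q ^ s) := by field_simp
    _ ≤ (2 / Δ) ^ 2 * (C * (CT ^ 2 * ∫ x, ‖χ x‖ ^ 2 ∂μ)) := by gcongr
    _ = _ := by ring

end Carleson

theorem proposition3p1 {d d' s : ℕ} (hs : 0 < s) (hsd : s < d)
    (α : ℝ) (K : RSpace d → CSpace d') (hK : IsCZKernel s α K)
    (hrigid : IsADRigid s α K)
    (μ : Measure (RSpace d)) [IsLocallyFiniteMeasure μ]
    (hμ : IsADRegular s μ) (hbdd : IsBoundedInL2 s α K μ)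
    (D : DyadicLattice d) :
    ∀ δ : ℝ, 0 < δ → D.IsCarlesonFamily s {Q | D.IsNonLCV μ δ Q} := by
  intro δ hδ
  obtain ⟨Λ, hΛ, hμΛ⟩ := hμ
  obtain ⟨CT, hCT⟩ := hbdd
  obtain ⟨A, Δ, hA, hΔ, hlarge⟩ :=
    exists_large_lipPairing_of_scale hs hK hrigid hΛ hδ (d * 2) μ hμΛ
  obtain ⟨CG, hCG, hgram⟩ := D.exists_sum_norm_integral_le hΛ.le hA s
  have hbump : ∀ Q, ∃ f : RSpace d → ℂ, D.IsNonLCV μ δ Q →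
      IsAdapted μ A (D.center Q) (D.side Q) f ∧
      ∀ χ : RSpace d → ℂ, IsLipZero χ → (∀ x, ‖χ x‖ ≤ 1) →
        (∀ x, ‖x - D.center Q‖ < A * D.side Q → χ x = 1) →
        Δ * D.side Q ^ s ≤ ‖lipPairing K μ f χ‖ := by
    intro Q
    by_cases hQ : D.IsNonLCV μ δ Q
    · obtain ⟨x, ⟨hx, hxs⟩, y, ⟨hy, hys⟩, hempty⟩ := hQ
      obtain ⟨f, h1, h2, h3, h4, h5⟩ := hlarge (D.center Q) (D.side Q) (D.side_pos Q) x hxs y hys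
        (D.norm_sub_center_le_of_mem_closure_tripleCube hx)
        (D.norm_sub_center_le_of_mem_closure_tripleCube hy) hempty
      exact ⟨f, fun _ => ⟨⟨h1, h2, h3, h4⟩, h5⟩⟩
    · exact ⟨0, fun h => absurd h hQ⟩
  choose φ hφ using hbump
  set M : ℝ := A + d with hM
  have hM0 : 0 < M := by positivity
  refine ⟨CG * CT ^ 2 * (2 / Δ) ^ 2 * (Λ * (2 * M) ^ s) + 1, by positivity, fun P => ?_⟩
  have hP := D.side_pos P
  -- A cutoff that is `1` on `B(x_P, M ℓ(P))`, hence on `B(x_Q, A ℓ(Q))` for all `Q ⊆ P`.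
  set χ : RSpace d → ℂ := fun y =>
    (tent (D.center P) (M * D.side P) (2 * M * D.side P) y : ℂ) with hχdef
  have hMlt : M * D.side P < 2 * M * D.side P := by
    have := mul_pos hM0 hP
    linarith
  have bχ := isLipBump_tent (D.center P) hMlt
  have hχsq : ∫ x, ‖χ x‖ ^ 2 ∂μ ≤ Λ * (2 * M * D.side P) ^ s := by
    have h1 := norm_integral_le_of_eq_zero_off_ball (m := μ) (h := fun x => ‖χ x‖ ^ 2)
      (x₀ := D.center P) (R := 2 * M * D.side P) (ε := 1) (C := Λ * (2 * M * D.side P) ^ s)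
      (fun x => by
        rw [norm_pow, norm_norm]
        exact pow_le_one₀ (norm_nonneg _) (bχ.bound x))
      (by positivity) (hμΛ.1 _ _ (by positivity)) (fun x hx => by
        rw [Metric.mem_ball, not_lt] at hx
        simp [hχdef, tent_eq_zero hMlt hx])
    rw [one_mul] at h1
    exact (Real.le_norm_self _).trans h1
  rw [ENNReal.tsum_eq_iSup_sum]
  refine iSup_le fun t => ?_
  set I : Finset (DyadicIndex d) := t.map (Function.Embedding.subtype _) with hI
  have hmem : ∀ Q ∈ I, D.IsNonLCV μ δ Q ∧ D.cube Q ⊆ D.cube P := by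
    intro Q hQ
    obtain ⟨q, -, rfl⟩ := Finset.mem_map.1 hQ
    exact q.2
  have hadapted : ∀ Q ∈ I, IsAdapted μ A (D.center Q) (D.side Q) (φ Q) := fun Q hQ =>
    (hφ Q (hmem Q hQ).1).1
  have hsum := sum_side_pow_le D hs hK hμΛ.1 hΛ.le hCT hCG hΔ hadapted
    (hgram μ inferInstance hμΛ.1 φ I hadapted) bχ.isLipZero (fun Q hQ => by
      refine (hφ Q (hmem Q hQ).1).2 _ bχ.isLipZero bχ.bound fun x hx => ?_
      have h1 := D.norm_center_sub_center_le (hmem Q hQ).2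
      have h2 := mul_le_mul_of_nonneg_left (D.side_le_side (hs.trans hsd) (hmem Q hQ).2) hA.le
      have h3 := norm_sub_le_norm_sub_add_norm_sub x (D.center Q) (D.center P)
      rw [tent_eq_one hMlt, Complex.ofReal_one]
      rw [dist_eq_norm, hM, add_mul]
      linarith)
  rw [← ENNReal.ofReal_sum_of_nonneg fun Q _ => pow_nonneg (D.side_pos Q.1).le s]
  refine ENNReal.ofReal_le_ofReal ?_
  have hsumt : ∑ Q ∈ t, D.side Q.1 ^ s = ∑ Q ∈ I, D.side Q ^ s := by
    rw [hI, Finset.sum_map]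
    rfl
  rw [hsumt]
  refine hsum.trans ?_
  calc _ ≤ CG * CT ^ 2 * (2 / Δ) ^ 2 * (Λ * (2 * M * D.side P) ^ s) := by gcongr
    _ ≤ _ := by
      have : 0 ≤ D.side P ^ s := by positivity
      rw [mul_pow (2 * M)]
      linarith
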